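/- Let $\mathbb{F}$ be an algebraically closed field of characteristic $p\ge 5$, and let $W=W_1=\mathrm{Der}(\mathbb{F}[X]/(X^p))$ be the Witt algebra, with basis $e_i=x^{i+1}\frac{\partial}{\partial x}$ ($-1\le i\le p-2$, $x$ the class of $X$) and bracket $[e_i,e_j]=(j-i)e_{i+j}$ (where $e_k=0$ for $k\notin\{-1,\dots,p-2\}$). It is a restricted Lie algebra with $p$-map $D\mapsto D^{[p]}=D^p$ (so $e_i^{[p]}=\delta_{i,0}e_i$). A $W$-module $V$ with representation $\rho$ is *restricted* if $\rho(D^{[p]})=\rho(D)^p$ for all $D\in W$. A bilinear product $V\times V\to V$, $(u,v)\mapsto u\cdot v$, on a $W$-module $V$ is *invariant* if $D(u\cdot v)=D(u)\cdot v+u\cdot D(v)$ for all $D\in W$, $u,v\in V$. Call a $W$-module *admissible* if it is irreducible, restricted, non-trivial, and not isomorphic to the adjoint module. 1. If $p\ne 7$, no admissible $W$-module has a nonzero invariant bilinear product. 2. If $p=7$, let $V_6$ be the space of homogeneous polynomials of degree $6$ in $\mathbb{F}[x,y]$, with basis $m_i=x^{6-i}y^i$ ($0\le i\le 6$), with $W$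 acting by $$e_k(m_i)=\begin{cases}(i+4k+4)\,m_{i+k}&\text{if }0\le i+k\le 6,\\ 0&\text{otherwise,}\end{cases}\qquad -1\le k\le 5,$$ and with the bilinear product $$m_i\cdot m_j=c(i,j)\,m_{i+j-3},\qquad c(i,j)=2(j-i)(4i+j-1)(4j+i-1)\in\mathbb{F}_7\subseteq\mathbb{F},$$ where the index $i+j-3$ is taken modulo $7$. Then $V_6$ is an admissible $W$-module, and this product is nonzero, invariant, and equal to the $3$-transvectant $$f\cdot g=(f,g)_3=\Bigl(\frac{3!}{6!}\Bigr)^2\sum_{r=0}^{3}(-1)^r\binom{3}{r}\frac{\partial^3 f}{\partial x^{3-r}\partial y^r}\,\frac{\partial^3 g}{\partial x^{r}\partial y^{3-r}}\qquad(f,g\in V_6).$$ Every invariant bilinear product on $V_6$ is a scalar multiple of it. Moreover, if $V$ is any admissible $W$-module with a nonzero invariant bilinear product $*$, then there are an isomorphism of $W$-modules $\varphi\colon V\to V_6$ and a nonzero scalar $a\in\mathbb{F}$ such that $\varphi(u*v)=a\,\varphi(u)\cdot\varphi(v)$ for all $u,v\in V$. -/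

import Mathlib

universe u v

namespace WittAlg

/-- The truncated polynomial algebra `F[X]/(X^n)`; the class of `X` is `AdjoinRoot.root (X ^ n)`. -/
abbrev TruncPoly (F : Type*) [Field F] (n : ℕ) : Type _ :=
  AdjoinRoot (Polynomial.X ^ n : Polynomial F)

/-- The Witt algebra `W₁ = Der(F[X]/(X^p))` (for `F` of characteristic `p`), a Lie algebra under
the commutator of derivations. -/
abbrev WittAlgebra (F : Type*) [Field F] (p : ℕ) : Type _ :=
  Derivation F (TruncPoly F p) (TruncPoly F p)

section Restricted

/-- The general Leibniz rule for the iterates of a derivation. -/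
theorem iterate_leibniz {F A : Type*} [Field F] [CommRing A] [Algebra F A] (D : Derivation F A A)
    (n : ℕ) (a b : A) :
    D^[n] (a * b) =
      ∑ ij ∈ Finset.HasAntidiagonal.antidiagonal n, n.choose ij.1 • (D^[ij.1] a * D^[ij.2] b) := by
  induction n with
  | zero => simp
  | succ n ih =>
    rw [Finset.sum_antidiagonal_choose_succ_nsmul (M := A) (fun i j => D^[i] a * D^[j] b) n]
    simp only [Function.iterate_succ_apply', ih, map_sum, map_nsmul, Derivation.leibniz,
      smul_eq_mul, smul_add, Finset.sum_add_distrib, add_right_inj]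
    refine Finset.sum_congr rfl fun ⟨i, j⟩ hij ↦ ?_
    rw [n.choose_symm_of_eq_add (Finset.HasAntidiagonal.mem_antidiagonal.1 hij).symm, mul_comm]

/-- In characteristic `p`, the `p`-th power (`p`-fold composite) of a derivation is a derivation.
This is the `p`-map `D ↦ D^[p]` of the restricted Lie algebra of derivations. -/
def pMap {F A : Type*} [Field F] [CommRing A] [Algebra F A] (p : ℕ) [Fact p.Prime] [CharP F p]
    (D : Derivation F A A) : Derivation F A A :=
  Derivation.mk' ((D : A →ₗ[F] A) ^ p) (by
    have hp : p.Prime := Fact.out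
    intro a b
    have key : ∀ c : A, ((D : A →ₗ[F] A) ^ p) c = D^[p] c := fun c => by
      rw [Module.End.pow_apply]; rfl
    simp only [key, smul_eq_mul]
    rw [iterate_leibniz, Finset.Nat.sum_antidiagonal_eq_sum_range_succ
      (fun i j => p.choose i • (D^[i] a * D^[j] b)) p, Finset.sum_range_succ,
      Finset.sum_eq_single 0]
    · simp [add_comm, mul_comm]
    · intro k hk hk0
      have hd : p ∣ p.choose k :=
        hp.dvd_choose_self hk0 (Finset.mem_range.1 hk)
      rw [← Nat.cast_smul_eq_nsmul F, (CharP.cast_eq_zero_iff F p _).2 hd, zero_smul]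
    · intro h
      exact absurd (Finset.mem_range.2 hp.pos) h)

/-- A `W₁`-module `V`, with representation `ρ`, is restricted if `ρ(D^[p]) = ρ(D)^p` for all `D`. -/
def IsRestricted (F : Type*) [Field F] (p : ℕ) [Fact p.Prime] [CharP F p]
    (V : Type*) [AddCommGroup V] [Module F V] [LieRingModule (WittAlgebra F p) V]
    [LieModule F (WittAlgebra F p) V] : Prop :=
  ∀ D : WittAlgebra F p,
    LieModule.toEnd F (WittAlgebra F p) V (pMap p D) = LieModule.toEnd F (WittAlgebra F p) V D ^ p

/-- A non-trivial, non-adjoint, restricted irreducible module for `W₁`. (No finiteness of the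
dimension is imposed.) -/
structure IsAdmissible (F : Type*) [Field F] (p : ℕ) [Fact p.Prime] [CharP F p]
    (V : Type*) [AddCommGroup V] [Module F V] [LieRingModule (WittAlgebra F p) V]
    [LieModule F (WittAlgebra F p) V] : Prop where
  irreducible : LieModule.IsIrreducible F (WittAlgebra F p) V
  restricted : IsRestricted F p V
  non_trivial : ¬ LieModule.IsTrivial (WittAlgebra F p) V
  non_adjoint : IsEmpty (V ≃ₗ⁅F, WittAlgebra F p⁆ WittAlgebra F p)

end Restricted

/-- A bilinear product `B` on an `L`-module `V` is invariant if `L` acts on `(V, B)` by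
derivations. -/
def IsInvariantProduct (F L : Type*) [Field F] [LieRing L] [LieAlgebra F L]
    {V : Type*} [AddCommGroup V] [Module F V] [LieRingModule L V] [LieModule F L V]
    (B : V →ₗ[F] V →ₗ[F] V) : Prop :=
  ∀ (x : L) (u v : V), ⁅x, B u v⁆ = B ⁅x, u⁆ v + B u ⁅x, v⁆

section Transvectant

/-- The `q`-transvectant `(f, g)_q` of binary forms `f` of degree `i` and `g` of degree `j`, where
`x = X 0` and `y = X 1`. -/
noncomputable def transvectant {F : Type*} [Field F] (i j q : ℕ)
    (f g : MvPolynomial (Fin 2) F) : MvPolynomial (Fin 2) F :=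
  ((((i - q).factorial : F) / (i.factorial : F)) * (((j - q).factorial : F) / (j.factorial : F))) •
    ∑ r ∈ Finset.range (q + 1), ((-1 : F) ^ r * (q.choose r : F)) •
      (((MvPolynomial.pderiv 0)^[q - r] ((MvPolynomial.pderiv 1)^[r] f)) *
        ((MvPolynomial.pderiv 0)^[r] ((MvPolynomial.pderiv 1)^[q - r] g)))

/-- `V₆`: the space of binary forms of degree `6` in `x = X 0` and `y = X 1`. -/
abbrev V6 (F : Type*) [Field F] : Type _ :=
  ↥(MvPolynomial.homogeneousSubmodule (Fin 2) F 6)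

/-- The exponent vector of `x^(6-i) y^i`. -/
noncomputable def expo (i : Fin 7) : Fin 2 →₀ ℕ :=
  Finsupp.single 0 (6 - (i : ℕ)) + Finsupp.single 1 (i : ℕ)

theorem expo_zero (i : Fin 7) : expo i 0 = 6 - (i : ℕ) := by simp [expo]

theorem expo_one (i : Fin 7) : expo i 1 = (i : ℕ) := by simp [expo]

theorem degree_fin_two (d : Fin 2 →₀ ℕ) : d.degree = d 0 + d 1 := by
  simp [Finsupp.degree_eq_sum]

theorem degree_expo (i : Fin 7) : (expo i).degree = 6 := by
  rw [degree_fin_two, expo_zero, expo_one]; omega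

theorem expo_injective : Function.Injective expo := fun i j h => by
  have := DFunLike.congr_fun h 1
  rw [expo_one, expo_one] at this
  exact Fin.ext this

theorem exists_expo (d : Fin 2 →₀ ℕ) (hd : d.degree = 6) : ∃ i, expo i = d := by
  rw [degree_fin_two] at hd
  refine ⟨⟨d 1, by omega⟩, ?_⟩
  ext k
  fin_cases k
  · simp [expo_zero]; omega
  · simp [expo_one]

variable (F : Type*) [Field F]

/-- `m_i = x^(6-i) y^i`, for `0 ≤ i ≤ 6`. -/
noncomputable def m (i : Fin 7) : V6 F :=
  ⟨MvPolynomial.X 0 ^ (6 - (i : ℕ)) * MvPolynomial.X 1 ^ (i : ℕ), by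
    have h := (MvPolynomial.isHomogeneous_X_pow (R := F) (0 : Fin 2) (6 - (i : ℕ))).mul
      (MvPolynomial.isHomogeneous_X_pow (R := F) (1 : Fin 2) (i : ℕ))
    rwa [show 6 - (i : ℕ) + (i : ℕ) = 6 by omega] at h⟩

theorem coe_m (i : Fin 7) : (m F i : MvPolynomial (Fin 2) F) = MvPolynomial.monomial (expo i) 1 := by
  simp [m, expo, MvPolynomial.X_pow_eq_monomial, MvPolynomial.monomial_mul]

theorem coeff_m (i j : Fin 7) :
    MvPolynomial.coeff (expo j) (m F i : MvPolynomial (Fin 2) F) = if i = j then 1 else 0 := by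
  rw [coe_m, MvPolynomial.coeff_monomial]
  simp [expo_injective.eq_iff]

/-- The basis `m_0, …, m_6` of `V₆`. -/
noncomputable def mBasis : Module.Basis (Fin 7) F (V6 F) :=
  .ofEquivFun
    { toFun := fun f i => MvPolynomial.coeff (expo i) (f : MvPolynomial (Fin 2) F)
      invFun := fun c => ∑ i, c i • m F i
      map_add' := fun f g => by ext i; simp
      map_smul' := fun a f => by ext i; simp
      left_inv := fun f => by
        apply Subtype.ext
        ext d
        simp only [AddSubmonoidClass.coe_finsetSum, SetLike.val_smul, MvPolynomial.coeff_sum,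
          MvPolynomial.coeff_smul, smul_eq_mul]
        by_cases hd : d.degree = 6
        · obtain ⟨i, rfl⟩ := exists_expo d hd
          simp [coeff_m]
        · have hf := (MvPolynomial.mem_homogeneousSubmodule 6 _).1 f.2
          rw [hf.coeff_eq_zero hd]
          refine Finset.sum_eq_zero fun i _ => ?_
          have hm := (MvPolynomial.mem_homogeneousSubmodule 6 _).1 (m F i).2
          rw [hm.coeff_eq_zero hd, mul_zero]
      right_inv := fun c => by
        ext j
        simp [MvPolynomial.coeff_sum, coeff_m] }

@[simp] theorem mBasis_apply (i : Fin 7) : mBasis F i = m F i := by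
  rw [mBasis, Module.Basis.coe_ofEquivFun]
  simp [Pi.single_apply]

/-- The structure constants `c(i,j) = 2 (j-i) (4i+j-1) (4j+i-1)`. -/
def c (i j : Fin 7) : F :=
  2 * ((j : ℕ) - (i : ℕ) : F) * (4 * (i : ℕ) + (j : ℕ) - 1 : F) * (4 * (j : ℕ) + (i : ℕ) - 1 : F)

/-- The product of `V₆`: the bilinear map with `m_i · m_j = c(i,j) m_{i+j-3}`, where the index
`i + j - 3` is computed in `Fin 7`, that is, modulo `7`. -/
noncomputable def V6prod : V6 F →ₗ[F] V6 F →ₗ[F] V6 F :=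
  (mBasis F).constr F fun i => (mBasis F).constr F fun j => c F i j • m F (i + j - 3)

theorem V6prod_m (i j : Fin 7) : V6prod F (m F i) (m F j) = c F i j • m F (i + j - 3) := by
  rw [V6prod, ← mBasis_apply, ← mBasis_apply F j, Module.Basis.constr_basis,
    Module.Basis.constr_basis]

/-- The endomorphism `e_{k-1}` of `V₆`, for `0 ≤ k ≤ 6`: it maps `m_i` to
`(i + 4 k) m_{i+k-1}` if `0 ≤ i + k - 1 ≤ 6`, and to `0` otherwise. -/
noncomputable def eEnd (k : Fin 7) : V6 F →ₗ[F] V6 F :=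
  (mBasis F).constr F fun i =>
    if h : 1 ≤ (i : ℕ) + (k : ℕ) ∧ (i : ℕ) + (k : ℕ) ≤ 7 then
      ((i : ℕ) + 4 * (k : ℕ) : F) • m F ⟨(i : ℕ) + (k : ℕ) - 1, by omega⟩
    else 0

/-- The coefficient of `x^k` in an element of `F[X]/(X^7)`, where `x` is the class of `X`. -/
noncomputable def truncCoeff (k : ℕ) : TruncPoly F 7 →ₗ[F] F :=
  Polynomial.lcoeff F k ∘ₗ AdjoinRoot.modByMonicHom (Polynomial.monic_X_pow 7)

/-- The action of the Witt algebra on `V₆`: the derivation `D = ∑ a_k x^k d/dx`, where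
`D(x) = ∑ a_k x^k`, acts as `∑ a_k e_{k-1}`. -/
noncomputable def V6act : WittAlgebra F 7 →ₗ[F] V6 F →ₗ[F] V6 F :=
  LinearMap.mk₂ F
    (fun D v => ∑ k : Fin 7, truncCoeff F k (D (AdjoinRoot.root _)) • eEnd F k v)
    (fun D E v => by simp [add_smul, Finset.sum_add_distrib])
    (fun a D v => by simp [Finset.smul_sum, mul_smul])
    (fun D v w => by simp [Finset.sum_add_distrib])
    (fun a D v => by
      simp only [map_smul, Finset.smul_sum]
      exact Finset.sum_congr rfl fun k _ => smul_comm _ _ _)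

theorem V6act_apply (D : WittAlgebra F 7) (v : V6 F) :
    V6act F D v = ∑ k : Fin 7, truncCoeff F k (D (AdjoinRoot.root _)) • eEnd F k v := rfl

section LieProof

/-- `x^7 = 0`. -/
theorem root_pow_seven : (AdjoinRoot.root (Polynomial.X ^ 7 : Polynomial F)) ^ 7 = 0 := by
  rw [← AdjoinRoot.mk_X, ← map_pow, AdjoinRoot.mk_self]

theorem truncCoeff_root_pow (i k : ℕ) (hi : i < 7) :
    truncCoeff F k ((AdjoinRoot.root (Polynomial.X ^ 7 : Polynomial F)) ^ i) =
      if i = k then 1 else 0 := by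
  have h : (Polynomial.X ^ i : Polynomial F) %ₘ (Polynomial.X ^ 7) = Polynomial.X ^ i := by
    rw [Polynomial.modByMonic_eq_self_iff (Polynomial.monic_X_pow 7), Polynomial.degree_X_pow,
      Polynomial.degree_X_pow]
    exact_mod_cast hi
  rw [← AdjoinRoot.mk_X, ← map_pow, truncCoeff, LinearMap.comp_apply, AdjoinRoot.modByMonicHom_mk,
    h, Polynomial.lcoeff_apply, Polynomial.coeff_X_pow]
  simp [eq_comm]

theorem eq_sum_truncCoeff (a : TruncPoly F 7) :
    a = ∑ k : Fin 7, truncCoeff F k a • (AdjoinRoot.root (Polynomial.X ^ 7 : Polynomial F)) ^ (k : ℕ)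
    := by
  have hm := Polynomial.monic_X_pow (R := F) 7
  have hlt : (AdjoinRoot.modByMonicHom hm a).natDegree < 7 := by
    obtain ⟨f, rfl⟩ := AdjoinRoot.mk_surjective a
    rw [AdjoinRoot.modByMonicHom_mk]
    have := Polynomial.natDegree_modByMonic_lt f hm (fun h => by
      have := congrArg Polynomial.natDegree h
      simp at this)
    simpa using this
  conv_lhs => rw [← AdjoinRoot.mk_leftInverse hm a, Polynomial.as_sum_range' _ 7 hlt]
  rw [map_sum, Finset.sum_range]
  refine Finset.sum_congr rfl fun k _ => ?_
  rw [← Polynomial.C_mul_X_pow_eq_monomial, map_mul, map_pow, AdjoinRoot.mk_X, AdjoinRoot.mk_C,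
    Algebra.smul_def]
  rfl

/-- The linear embedding of `V₆` into `F[X]/(X^7)` with `m_i ↦ x^i`. -/
noncomputable def toTrunc : V6 F →ₗ[F] TruncPoly F 7 :=
  (mBasis F).constr F fun i => AdjoinRoot.root (Polynomial.X ^ 7 : Polynomial F) ^ (i : ℕ)

theorem toTrunc_m (i : Fin 7) : toTrunc F (m F i) = AdjoinRoot.root _ ^ (i : ℕ) := by
  rw [toTrunc, ← mBasis_apply, Module.Basis.constr_basis]

theorem toTrunc_injective : Function.Injective (toTrunc F) := by
  rw [injective_iff_map_eq_zero]
  intro v hv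
  rw [← (mBasis F).sum_repr v] at hv ⊢
  refine Finset.sum_eq_zero fun j _ => ?_
  have h := congrArg (truncCoeff F (j : ℕ)) hv
  simp only [map_sum, map_smul, mBasis_apply, toTrunc_m, map_zero] at h
  rw [Finset.sum_eq_single j] at h
  · rw [truncCoeff_root_pow F _ _ j.2, if_pos rfl, smul_eq_mul, mul_one] at h
    rw [h, zero_smul]
  · intro i _ hij
    rw [truncCoeff_root_pow F _ _ i.2, if_neg (fun h => hij (Fin.ext h)), smul_zero]
  · simp

variable [CharP F 7]

theorem derivative_mem_aux (f : Polynomial F)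
    (hf : AdjoinRoot.mkₐ (R := F) (Polynomial.X ^ 7 : Polynomial F) f = 0) :
    AdjoinRoot.mkₐ (R := F) (Polynomial.X ^ 7 : Polynomial F) (Polynomial.derivative' f) = 0 := by
  change AdjoinRoot.mk _ f = 0 at hf
  change AdjoinRoot.mk _ (Polynomial.derivative f) = 0
  rw [AdjoinRoot.mk_eq_zero] at hf ⊢
  obtain ⟨g, rfl⟩ := hf
  have h7 : ((7 : ℕ) : F) = 0 := CharP.cast_eq_zero F 7
  rw [Polynomial.derivative_mul, Polynomial.derivative_X_pow, h7, map_zero, zero_mul, zero_mul,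
    zero_add]
  exact dvd_mul_right _ _

/-- The derivation `d/dx` of `F[X]/(X^7)`. -/
noncomputable def ddx : WittAlgebra F 7 :=
  Derivation.liftOfSurjective (f := AdjoinRoot.mkₐ (R := F) (Polynomial.X ^ 7 : Polynomial F))
    (d := Polynomial.derivative') AdjoinRoot.mk_surjective (derivative_mem_aux F)

theorem ddx_root : ddx F (AdjoinRoot.root _) = 1 := by
  have h := Derivation.liftOfSurjective_apply (R := F) (d := Polynomial.derivative')
    (f := AdjoinRoot.mkₐ (R := F) (Polynomial.X ^ 7 : Polynomial F)) AdjoinRoot.mk_surjective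
    (derivative_mem_aux F) Polynomial.X
  have h1 : Polynomial.derivative' (R := F) Polynomial.X = 1 := Polynomial.derivative_X
  rw [h1, map_one] at h
  exact h

theorem eq_mul_ddx (D : WittAlgebra F 7) (a : TruncPoly F 7) :
    D a = D (AdjoinRoot.root _) * ddx F a := by
  have h : D = D (AdjoinRoot.root _) • ddx F := by
    refine Derivation.ext_of_adjoin_eq_top _ (AdjoinRoot.adjoinRoot_eq_top (f := Polynomial.X ^ 7))
      ?_
    intro y hy
    rw [Set.mem_singleton_iff.1 hy, Derivation.smul_apply, ddx_root, smul_eq_mul, mul_one]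
  exact DFunLike.congr_fun h a

/-- The action of `D` on `F[X]/(X^7)` twisted by four times the divergence. -/
noncomputable def tw (D : WittAlgebra F 7) (a : TruncPoly F 7) : TruncPoly F 7 :=
  D a + 4 * (ddx F (D (AdjoinRoot.root _)) * a)

theorem tw_lie (D E : WittAlgebra F 7) (a : TruncPoly F 7) :
    tw F ⁅D, E⁆ a = tw F D (tw F E a) - tw F E (tw F D a) := by
  have h4 : ddx F (4 : TruncPoly F 7) = 0 := by
    exact_mod_cast Derivation.map_natCast (ddx F) 4
  simp only [tw, Derivation.commutator_apply]
  generalize hu : D (AdjoinRoot.root _) = u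
  generalize hv : E (AdjoinRoot.root _) = v
  have hD : ∀ b, D b = u * ddx F b := fun b => by rw [eq_mul_ddx, hu]
  have hE : ∀ b, E b = v * ddx F b := fun b => by rw [eq_mul_ddx, hv]
  simp only [hD, hE, map_add, map_sub, Derivation.leibniz, smul_eq_mul, h4]
  ring

theorem toTrunc_eEnd (k i : Fin 7) :
    toTrunc F (eEnd F k (m F i)) = AdjoinRoot.root _ ^ (k : ℕ) * ddx F (AdjoinRoot.root _ ^ (i : ℕ))
      + 4 * (ddx F (AdjoinRoot.root _ ^ (k : ℕ)) * AdjoinRoot.root _ ^ (i : ℕ)) := by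
  rw [eEnd, ← mBasis_apply, Module.Basis.constr_basis]
  simp only [Derivation.leibniz_pow, ddx_root, smul_eq_mul, mul_one, nsmul_eq_mul]
  have key : ∀ n : ℕ, 7 ≤ n → (AdjoinRoot.root (Polynomial.X ^ 7 : Polynomial F)) ^ n = 0 :=
    fun n hn => pow_eq_zero_of_le hn (root_pow_seven F)
  set x := AdjoinRoot.root (Polynomial.X ^ 7 : Polynomial F)
  have e1 : x ^ (k : ℕ) * (((i : ℕ) : TruncPoly F 7) * x ^ ((i : ℕ) - 1)) =
      ((i : ℕ) : TruncPoly F 7) * x ^ ((i : ℕ) + (k : ℕ) - 1) := by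
    rcases Nat.eq_zero_or_pos (i : ℕ) with h | h
    · simp [h]
    · rw [show (i : ℕ) + (k : ℕ) - 1 = (k : ℕ) + ((i : ℕ) - 1) by omega, pow_add]; ring
  have e2 : ((k : ℕ) : TruncPoly F 7) * x ^ ((k : ℕ) - 1) * x ^ (i : ℕ) =
      ((k : ℕ) : TruncPoly F 7) * x ^ ((i : ℕ) + (k : ℕ) - 1) := by
    rcases Nat.eq_zero_or_pos (k : ℕ) with h | h
    · simp [h]
    · rw [show (i : ℕ) + (k : ℕ) - 1 = ((k : ℕ) - 1) + (i : ℕ) by omega, pow_add]; ring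
  rw [e1, e2]
  split_ifs with h
  · rw [map_smul, toTrunc_m, Algebra.smul_def]
    simp only [map_add, map_mul, map_natCast, map_ofNat]
    ring
  · rw [map_zero]
    by_cases h1 : (i : ℕ) + (k : ℕ) ≤ 7
    · have hi : (i : ℕ) = 0 := by omega
      have hk : (k : ℕ) = 0 := by omega
      simp [hi, hk]
    · rw [key _ (by omega)]; ring

theorem toTrunc_V6act (D : WittAlgebra F 7) (v : V6 F) :
    toTrunc F (V6act F D v) = tw F D (toTrunc F v) := by
  have hD := eq_sum_truncCoeff F (D (AdjoinRoot.root _))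
  have hb : ∀ i : Fin 7, toTrunc F (V6act F D (m F i)) = tw F D (toTrunc F (m F i)) := by
    intro i
    rw [V6act_apply, tw, toTrunc_m, eq_mul_ddx F D (AdjoinRoot.root _ ^ (i : ℕ))]
    conv_rhs => rw [hD]
    simp only [map_sum, map_smul, Derivation.map_smul, toTrunc_eEnd, Finset.sum_mul, Finset.mul_sum,
      ← Finset.sum_add_distrib]
    refine Finset.sum_congr rfl fun k _ => ?_
    simp only [Algebra.smul_def]
    ring
  rw [← (mBasis F).sum_repr v]
  simp only [tw, map_sum, map_smul, Derivation.map_smul, mBasis_apply, Finset.mul_sum, ← Finset.sum_add_distrib, hb]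
  refine Finset.sum_congr rfl fun k _ => ?_
  simp only [Algebra.smul_def]
  ring

theorem V6act_lie (D E : WittAlgebra F 7) (v : V6 F) :
    V6act F ⁅D, E⁆ v = V6act F D (V6act F E v) - V6act F E (V6act F D v) := by
  apply toTrunc_injective
  rw [map_sub, toTrunc_V6act, toTrunc_V6act, toTrunc_V6act, toTrunc_V6act, toTrunc_V6act, tw_lie]

end LieProof

variable [CharP F 7]

/-- The `W₁`-module structure of `V₆` in characteristic `7`. -/
noncomputable instance : LieRingModule (WittAlgebra F 7) (V6 F) where
  bracket D v := V6act F D v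
  add_lie D E v := by simp
  lie_add D v w := by simp
  leibniz_lie D E v := by rw [V6act_lie]; abel

theorem V6_lie_def (D : WittAlgebra F 7) (v : V6 F) : ⁅D, v⁆ = V6act F D v := rfl

instance : LieModule F (WittAlgebra F 7) (V6 F) where
  smul_lie a D v := by simp [V6_lie_def]
  lie_smul a D v := by simp [V6_lie_def]

/-- The derivation `e_{k-1} = x^k d/dx` acts on `V₆` as `eEnd k`. -/
theorem V6_lie_e (k : Fin 7) (D : WittAlgebra F 7)
    (hD : D (AdjoinRoot.root _) = AdjoinRoot.root _ ^ (k : ℕ)) (v : V6 F) :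
    ⁅D, v⁆ = eEnd F k v := by
  rw [V6_lie_def, V6act_apply, hD, Finset.sum_eq_single k]
  · rw [truncCoeff_root_pow F _ _ k.2, if_pos rfl, one_smul]
  · intro j _ hj
    rw [truncCoeff_root_pow F _ _ k.2, if_neg (fun h => hj (Fin.ext h.symm)), zero_smul]
  · simp

end Transvectant

instance : Fact (Nat.Prime 7) := ⟨by norm_num⟩

end WittAlg

/-!
Write `E k` for the derivation `x^k d/dx` of `F[X]/(X^p)`. A restricted module contains a vector `w`
killed by all `E k` with `2 ≤ k` that is an eigenvector of `E 1`
(`IsRestricted.exists_highestWeightVector`), because the `E k` with `k ≠ 1` act nilpotently. An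
irreducible restricted module is therefore spanned by the `(d/dx)^i w` with `i < p`. Suitably
scaled, these vectors `v j` transform like the tensor densities `x^j (dx)^b`, with
`b - 1` the eigenvalue of `w` (`IsRestricted.exists_isDensityFamily`). The same argument for the
dual module gives a functional `θ` that kills the images of all `E k` with `2 ≤ k` and is an
eigenvector of `E 1`; it plays the role of evaluation at `x = 0`. If the module is admissible,
either `b = 0` and the module is the space of functions modulo constants, or `b ≠ 0, 1, -1` and the
`v j` form a basis (`IsAdmissible.exists_isDensityFamily`).

An invariant product `B` on an irreducible module vanishes as soon as `θ ∘ B` does, since its image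
spans a submodule (`IsDensityFamily.product_eq_zero`). So only the values
`ψ i j = θ (B (v i) (v j))` matter. They satisfy the linear relations of `IsSemiInvariantForm`,
which force `ψ = 0` if `b = 0` (`IsSemiInvariantForm.eq_zero_of_exponent_zero`). If
`b ≠ 0, 1, -1`, a nonzero value forces `b = -n` for some `2 ≤ n ≤ p - 2`, by comparison of weights.
Then the value `ψ 0 n` determines `ψ` (`IsSemiInvariantForm.eq_zero`), and if it is nonzero,
comparing the relations that start at `(0, n)` and at `(n, 0)` gives `3 n = 2` and
`5 n = 8` in `F`. Hence `14 = 0`, so that `p = 7` and `n = 3` (`IsSemiInvariantForm.eq_seven`).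

For `p = 7`, the module `V₆` consists of the densities of exponent `4 = -3`, so the invariant
products on it form a space of dimension at most one. That the given product is invariant and equals
the transvectant is a finite computation with coefficients in `ZMod 7`. That `V₆` is restricted
follows from the Leibniz rule for `p`-th powers (`leibniz_pow_char`), by which the `p`-th power
of the action of `D` on densities of exponent `n` is `f ↦ D^p f + n g f`, with `g` independent of
`n`; and `g` is the divergence of `D^p`, because `d/dx` carries the action of `D` on functions to
its action on densities of exponent `1` (`twEnd_one_pow_one`).
-/

namespace WittAlg

/-! ### The Witt algebra in arbitrary characteristic -/

section Witt

variable (F : Type*) [Field F] (p : ℕ)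

theorem root_pow_eq_zero {n : ℕ} (h : p ≤ n) :
    (AdjoinRoot.root (Polynomial.X ^ p : Polynomial F)) ^ n = 0 := by
  refine pow_eq_zero_of_le h ?_
  rw [← AdjoinRoot.mk_X, ← map_pow, AdjoinRoot.mk_self]

variable {F p} in
theorem witt_ext {D D' : WittAlgebra F p}
    (h : D (AdjoinRoot.root _) = D' (AdjoinRoot.root _)) : D = D' := by
  refine Derivation.ext_of_adjoin_eq_top _ (AdjoinRoot.adjoinRoot_eq_top (f := Polynomial.X ^ p)) ?_
  intro y hy
  rw [Set.mem_singleton_iff.1 hy, h]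

variable [CharP F p]

variable {F p} in
theorem natCast_ne_zero_of_lt {n : ℕ} (h0 : 0 < n) (h : n < p) : (n : F) ≠ 0 := by
  rw [Ne, CharP.cast_eq_zero_iff F p]
  exact Nat.not_dvd_of_pos_of_lt h0 h

theorem mkₐ_derivative (f : Polynomial F)
    (hf : AdjoinRoot.mkₐ (R := F) (Polynomial.X ^ p : Polynomial F) f = 0) :
    AdjoinRoot.mkₐ (R := F) (Polynomial.X ^ p : Polynomial F) (Polynomial.derivative' f) = 0 := by
  change AdjoinRoot.mk _ f = 0 at hf
  change AdjoinRoot.mk _ (Polynomial.derivative f) = 0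
  rw [AdjoinRoot.mk_eq_zero] at hf ⊢
  obtain ⟨g, rfl⟩ := hf
  rw [Polynomial.derivative_mul, Polynomial.derivative_X_pow, CharP.cast_eq_zero F p, map_zero,
    zero_mul, zero_mul, zero_add]
  exact dvd_mul_right _ _

/-- The derivation `d/dx` of `F[X]/(X^p)` in characteristic `p`. -/
noncomputable def dx : WittAlgebra F p :=
  Derivation.liftOfSurjective (f := AdjoinRoot.mkₐ (R := F) (Polynomial.X ^ p : Polynomial F))
    (d := Polynomial.derivative') AdjoinRoot.mk_surjective (mkₐ_derivative F p)

theorem dx_root : dx F p (AdjoinRoot.root _) = 1 := by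
  have h := Derivation.liftOfSurjective_apply (R := F) (d := Polynomial.derivative')
    (f := AdjoinRoot.mkₐ (R := F) (Polynomial.X ^ p : Polynomial F))
    AdjoinRoot.mk_surjective (mkₐ_derivative F p) Polynomial.X
  have h1 : Polynomial.derivative' (R := F) Polynomial.X = 1 := Polynomial.derivative_X
  rw [h1, map_one] at h
  exact h

/-- The derivation `x^k d/dx`, usually written `e_{k-1}`. It is zero for `p ≤ k`. -/
noncomputable def E (k : ℕ) : WittAlgebra F p :=
  (AdjoinRoot.root (Polynomial.X ^ p : Polynomial F)) ^ k • dx F p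

variable {F p}

theorem E_root (k : ℕ) : E F p k (AdjoinRoot.root _) = AdjoinRoot.root _ ^ k := by
  rw [E, Derivation.smul_apply, dx_root, smul_eq_mul, mul_one]

theorem E_eq_zero {k : ℕ} (h : p ≤ k) : E F p k = 0 := by
  rw [E, root_pow_eq_zero F p h, zero_smul]

theorem E_root_pow (k n : ℕ) :
    E F p k (AdjoinRoot.root _ ^ n) = (n : F) • AdjoinRoot.root _ ^ (n + k - 1) := by
  rw [Derivation.leibniz_pow, E_root, smul_eq_mul, ← pow_add, Nat.cast_smul_eq_nsmul]
  rcases Nat.eq_zero_or_pos n with rfl | hn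
  · simp
  · rw [show n - 1 + k = n + k - 1 by omega]

theorem E_lie (k l : ℕ) : ⁅E F p k, E F p l⁆ = ((l : F) - k) • E F p (k + l - 1) := by
  apply witt_ext
  rw [Derivation.commutator_apply, E_root, E_root, E_root_pow, E_root_pow, Derivation.smul_apply,
    E_root, sub_smul, add_comm l k]

theorem span_E : Submodule.span F (Set.range (E F p)) = ⊤ := by
  rw [eq_top_iff]
  intro D _
  obtain ⟨f, hf⟩ := AdjoinRoot.mk_surjective (D (AdjoinRoot.root _))
  have hD : D = D (AdjoinRoot.root _) • dx F p :=
    witt_ext (by rw [Derivation.smul_apply, dx_root, smul_eq_mul, mul_one])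
  rw [hD, ← hf, ← AdjoinRoot.aeval_eq, Polynomial.aeval_eq_sum_range, Finset.sum_smul]
  refine Submodule.sum_mem _ fun k _ => ?_
  rw [smul_assoc]
  exact Submodule.smul_mem _ _ (Submodule.subset_span ⟨k, rfl⟩)

variable [Fact p.Prime]

theorem pMap_apply {A : Type*} [CommRing A] [Algebra F A] (D : Derivation F A A) (a : A) :
    pMap p D a = D^[p] a := by
  change ((D : A →ₗ[F] A) ^ p) a = _
  rw [Module.End.pow_apply]
  rfl

theorem pMap_E_one : pMap p (E F p 1) = E F p 1 := by
  apply witt_ext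
  rw [pMap_apply, Function.iterate_fixed, E_root, pow_one]
  rw [E_root, pow_one]

theorem pMap_E {k : ℕ} (hk : k ≠ 1) : pMap p (E F p k) = 0 := by
  have hp : 2 ≤ p := (Fact.out : p.Prime).two_le
  apply witt_ext
  rw [pMap_apply, Derivation.zero_apply]
  rcases Nat.lt_or_ge k 1 with h0 | h2
  · obtain rfl : k = 0 := by omega
    have h2 : (E F p 0)^[2] (AdjoinRoot.root _) = 0 := by
      simp only [Function.iterate_succ_apply, Function.iterate_zero, id, E_root, pow_zero,
        Derivation.map_one_eq_zero]
    have h := Function.iterate_add_apply (E F p 0) (p - 2) 2 (AdjoinRoot.root _)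
    rwa [h2, iterate_map_zero, Nat.sub_add_cancel hp] at h
  · have key : ∀ n : ℕ, ∃ a : F, (E F p k)^[n] (AdjoinRoot.root _) =
        a • AdjoinRoot.root _ ^ (1 + n * (k - 1)) := by
      intro n
      induction n with
      | zero => exact ⟨1, by simp⟩
      | succ n ih =>
        obtain ⟨a, ha⟩ := ih
        refine ⟨a * ((1 + n * (k - 1) : ℕ) : F), ?_⟩
        rw [Function.iterate_succ_apply', ha, Derivation.map_smul, E_root_pow, mul_smul,
          show 1 + n * (k - 1) + k - 1 = 1 + (n + 1) * (k - 1) by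
            rw [add_mul, one_mul]; omega]
    obtain ⟨a, ha⟩ := key p
    rw [ha, root_pow_eq_zero F p, smul_zero]
    have : p * 1 ≤ p * (k - 1) := Nat.mul_le_mul_left _ (by omega)
    omega

end Witt

/-! ### Highest weight vectors of restricted modules -/

section Modules

variable {F : Type*} [Field F] {p : ℕ} [CharP F p]
  {V : Type*} [AddCommGroup V] [Module F V] [LieRingModule (WittAlgebra F p) V]
  [LieModule F (WittAlgebra F p) V]

theorem lie_mem_of_E (N : Submodule F V) {u : V} (h : ∀ k, ⁅E F p k, u⁆ ∈ N)
    (D : WittAlgebra F p) : ⁅D, u⁆ ∈ N := by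
  have hD : D ∈ Submodule.span F (Set.range (E F p)) := by
    rw [span_E]; exact Submodule.mem_top
  induction hD using Submodule.span_induction with
  | mem x hx => obtain ⟨k, rfl⟩ := hx; exact h k
  | zero => rw [zero_lie]; exact N.zero_mem
  | add x y _ _ hx hy => rw [add_lie]; exact N.add_mem hx hy
  | smul a x _ hx => rw [smul_lie]; exact N.smul_mem a hx

theorem lie_eq_zero_of_E {u : V} (h : ∀ k, ⁅E F p k, u⁆ = 0) (D : WittAlgebra F p) :
    ⁅D, u⁆ = 0 :=
  lie_mem_of_E ⊥ h D

/-- The submodule spanned by a set that the derivations `x^k d/dx` map into its span. -/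
def lieSpanOfE (S : Set V) (h : ∀ s ∈ S, ∀ k, ⁅E F p k, s⁆ ∈ Submodule.span F S) :
    LieSubmodule F (WittAlgebra F p) V :=
  { Submodule.span F S with
    lie_mem := by
      intro D u hu
      change ⁅D, u⁆ ∈ Submodule.span F S
      change u ∈ Submodule.span F S at hu
      induction hu using Submodule.span_induction with
      | mem x hx => exact lie_mem_of_E _ (h x hx) D
      | zero => rw [lie_zero]; exact Submodule.zero_mem _
      | add x y _ _ hx hy => rw [lie_add]; exact Submodule.add_mem _ hx hy
      | smul a x _ hx => rw [lie_smul]; exact Submodule.smul_mem _ a hx }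

theorem lieSpanOfE_toSubmodule (S : Set V)
    (h : ∀ s ∈ S, ∀ k, ⁅E F p k, s⁆ ∈ Submodule.span F S) :
    (lieSpanOfE S h).toSubmodule = Submodule.span F S := rfl

theorem span_eq_top_of_E [LieModule.IsIrreducible F (WittAlgebra F p) V] (S : Set V)
    (h : ∀ s ∈ S, ∀ k, ⁅E F p k, s⁆ ∈ Submodule.span F S) {s : V} (hs : s ∈ S) (hs0 : s ≠ 0) :
    Submodule.span F S = ⊤ := by
  rcases eq_bot_or_eq_top (lieSpanOfE S h) with hb | ht
  · exfalso
    have hm : s ∈ (lieSpanOfE S h).toSubmodule := Submodule.subset_span hs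
    rw [hb] at hm
    exact hs0 hm
  · rw [← lieSpanOfE_toSubmodule S h, ht, LieSubmodule.top_toSubmodule]

/-- An irreducible module with a nonzero vector killed by the Witt algebra is trivial. -/
theorem isTrivial_of_E [LieModule.IsIrreducible F (WittAlgebra F p) V] {w : V} (hw : w ≠ 0)
    (h : ∀ k, ⁅E F p k, w⁆ = 0) : LieModule.IsTrivial (WittAlgebra F p) V := by
  rw [LieModule.isTrivial_iff_max_triv_eq_top F]
  refine (eq_bot_or_eq_top _).resolve_left fun hb => hw ?_
  have : w ∈ LieModule.maxTrivSubmodule F (WittAlgebra F p) V :=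
    (LieModule.mem_maxTrivSubmodule F _ V w).2 (lie_eq_zero_of_E h)
  rwa [hb] at this

/-- If a polynomial in `f` vanishes, then every nonzero `f`-stable subspace, of whatever dimension,
contains an eigenvector of `f`. -/
theorem exists_eigenvector_mem {V : Type*} [AddCommGroup V] [Module F V] [IsAlgClosed F]
    (f : Module.End F V) (K : Submodule F V) (hK : ∀ u ∈ K, f u ∈ K) (hne : K ≠ ⊥)
    {P : Polynomial F} (hP : P ≠ 0) (h : Polynomial.aeval f P = 0) :
    ∃ a, P.IsRoot a ∧ ∃ u ∈ K, u ≠ 0 ∧ f u = a • u := by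
  have key : ∀ s : Multiset F, ∀ u ∈ K, u ≠ 0 →
      Polynomial.aeval f (s.map fun a => Polynomial.X - Polynomial.C a).prod u = 0 →
      ∃ a ∈ s, ∃ u ∈ K, u ≠ 0 ∧ f u = a • u := by
    intro s
    induction s using Multiset.induction with
    | empty =>
      intro u _ hu h
      simp [hu] at h
    | cons a s ih =>
      intro u huK hu h
      rw [Multiset.map_cons, Multiset.prod_cons, mul_comm, map_mul, Module.End.mul_apply,
        map_sub, Polynomial.aeval_X, Polynomial.aeval_C, LinearMap.sub_apply,
        Module.algebraMap_end_apply] at h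
      by_cases h0 : f u - a • u = 0
      · exact ⟨a, Multiset.mem_cons_self a s, u, huK, hu, sub_eq_zero.1 h0⟩
      · obtain ⟨b, hb, hu'⟩ := ih _ (K.sub_mem (hK u huK) (K.smul_mem a huK)) h0 h
        exact ⟨b, Multiset.mem_cons_of_mem hb, hu'⟩
  obtain ⟨u, huK, hu⟩ := Submodule.exists_mem_ne_zero_of_ne_bot hne
  obtain ⟨a, ha, hu'⟩ := key P.roots u huK hu (by
    rw [(IsAlgClosed.splits P).eq_prod_roots, map_mul, Polynomial.aeval_C] at h
    have h1 := LinearMap.congr_fun h u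
    rw [Module.End.mul_apply, Module.algebraMap_end_apply, LinearMap.zero_apply] at h1
    exact (smul_eq_zero.1 h1).resolve_left (Polynomial.leadingCoeff_ne_zero.2 hP))
  exact ⟨a, (Polynomial.mem_roots hP).1 ha, hu'⟩

theorem exists_ker_mem {V : Type*} [AddCommGroup V] [Module F V] [IsAlgClosed F]
    (f : Module.End F V) (K : Submodule F V) (hK : ∀ u ∈ K, f u ∈ K) (hne : K ≠ ⊥)
    {n : ℕ} (h : f ^ n = 0) : ∃ u ∈ K, u ≠ 0 ∧ f u = 0 := by
  obtain ⟨a, ha, u, hu, hu0, hfu⟩ := exists_eigenvector_mem f K hK hne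
    (pow_ne_zero n Polynomial.X_ne_zero) (by rw [map_pow, Polynomial.aeval_X, h])
  refine ⟨u, hu, hu0, ?_⟩
  have ha0 : a = 0 := by
    rw [Polynomial.IsRoot, Polynomial.eval_pow, Polynomial.eval_X] at ha
    exact eq_zero_of_pow_eq_zero ha
  rw [hfu, ha0, zero_smul]

variable [Fact p.Prime]

theorem IsRestricted.E_pow (h : IsRestricted F p V) {k : ℕ} (hk : k ≠ 1) :
    LieModule.toEnd F (WittAlgebra F p) V (E F p k) ^ p = 0 := by
  rw [← h, pMap_E hk, map_zero]

theorem IsRestricted.E_one_pow (h : IsRestricted F p V) :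
    LieModule.toEnd F (WittAlgebra F p) V (E F p 1) ^ p =
      LieModule.toEnd F (WittAlgebra F p) V (E F p 1) := by
  rw [← h, pMap_E_one]

theorem IsRestricted.dual (hp : p ≠ 2) (h : IsRestricted F p V) :
    IsRestricted F p (Module.Dual F V) := by
  intro D
  ext θ u
  have key : ∀ (n : ℕ) (θ : Module.Dual F V),
      (LieModule.toEnd F (WittAlgebra F p) (Module.Dual F V) D ^ n) θ =
        (-1 : F) ^ n • θ ∘ₗ (LieModule.toEnd F (WittAlgebra F p) V D ^ n) := by
    intro n
    induction n with
    | zero => intro θ; ext; simp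
    | succ n ih =>
      intro θ
      rw [pow_succ, Module.End.mul_apply, ih]
      ext u
      simp only [LinearMap.smul_apply, LinearMap.comp_apply, LieModule.toEnd_apply_apply,
        Module.Dual.lie_apply, pow_succ', Module.End.mul_apply, smul_eq_mul]
      ring
  rw [key, ← h, ((Fact.out : p.Prime).odd_of_ne_two hp).neg_one_pow]
  simp

/-- The elements `x^k d/dx` with `2 ≤ k` have a common null vector in a restricted module, and on
the space of those vectors `x d/dx` has an eigenvector. -/
theorem IsRestricted.exists_highestWeightVector [IsAlgClosed F] [Nontrivial V]
    (h : IsRestricted F p V) :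
    ∃ (w : V) (a : F), w ≠ 0 ∧ (∀ k, 2 ≤ k → ⁅E F p k, w⁆ = 0) ∧ ⁅E F p 1, w⁆ = a • w := by
  have hp : p.Prime := Fact.out
  let K : ℕ → Submodule F V := fun n => ⨅ k : {k // n ≤ k},
    LinearMap.ker (LieModule.toEnd F (WittAlgebra F p) V (E F p k))
  have memK : ∀ n u, u ∈ K n ↔ ∀ k, n ≤ k → ⁅E F p k, u⁆ = 0 := by
    intro n u
    simp [K, Submodule.mem_iInf]
  -- `E n` preserves `K (n + 1)` and is nilpotent, so `K n` is nonzero if `K (n + 1)` is.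
  have hK : K 2 ≠ ⊥ := by
    refine Nat.decreasingInduction' (P := fun n => K n ≠ ⊥) (m := 2) (n := p) ?_ hp.two_le ?_
    · intro n _ hn ih
      obtain ⟨u, hu, hu0, hEu⟩ := exists_ker_mem _ (K (n + 1)) (fun u hu => by
        rw [memK] at hu ⊢
        intro k hk
        rw [LieModule.toEnd_apply_apply, leibniz_lie, hu k hk, lie_zero, add_zero, E_lie, smul_lie,
          hu _ (by omega), smul_zero]) ih (h.E_pow (k := n) (by omega))
      refine Submodule.ne_bot_iff _ |>.2 ⟨u, (memK _ _).2 fun k hk => ?_, hu0⟩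
      rcases hk.eq_or_lt with rfl | hk
      · exact hEu
      · exact (memK _ _).1 hu k hk
    · obtain ⟨u, hu⟩ := exists_ne (0 : V)
      exact Submodule.ne_bot_iff _ |>.2 ⟨u, (memK _ _).2 fun k hk => by
        rw [E_eq_zero hk, zero_lie], hu⟩
  have hP : (Polynomial.X ^ p - Polynomial.X : Polynomial F) ≠ 0 :=
    FiniteField.X_pow_card_sub_X_ne_zero F hp.one_lt
  obtain ⟨a, _, w, hw, hw0, haw⟩ := exists_eigenvector_mem
    (LieModule.toEnd F (WittAlgebra F p) V (E F p 1)) (K 2) (fun u hu => by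
      rw [memK] at hu ⊢
      intro k hk
      rw [LieModule.toEnd_apply_apply, leibniz_lie, hu k hk, lie_zero, add_zero, E_lie, smul_lie,
        hu _ (by omega), smul_zero]) hK hP (by
      rw [map_sub, map_pow, Polynomial.aeval_X, h.E_one_pow, sub_self])
  exact ⟨w, a, hw0, (memK _ _).1 hw, haw⟩

end Modules

/-! ### Modules of tensor densities -/

section Density

variable {F : Type*} [Field F] {p : ℕ} [CharP F p]
  {V : Type*} [AddCommGroup V] [Module F V] [LieRingModule (WittAlgebra F p) V]

/-- A family `v` of generators of a module on which the Witt algebra acts as it does on the tensor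
densities `v j = x^j (dx)^b`, where `x^j = 0` for `p ≤ j`. The family may be linearly dependent.
For `j = k = 0` the truncated subtraction is harmless, since the coefficient vanishes. -/
structure IsDensityFamily (p : ℕ) [CharP F p] [LieRingModule (WittAlgebra F p) V] (b : F)
    (v : ℕ → V) : Prop where
  lie : ∀ k j, ⁅E F p k, v j⁆ = ((j : F) + b * k) • v (j + k - 1)
  eq_zero : ∀ j, p ≤ j → v j = 0
  span : Submodule.span F (Set.range v) = ⊤

/-- The vector fields are the densities of exponent `-1`. -/
theorem isDensityFamily_E : IsDensityFamily p (-1 : F) (E F p) where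
  lie k j := by rw [E_lie, add_comm k j, neg_one_mul, sub_eq_add_neg]
  eq_zero _ := E_eq_zero
  span := span_E

theorem IsDensityFamily.ne_zero {b : F} {v : ℕ → V} (hv : IsDensityFamily p b v) (h0 : v 0 ≠ 0) :
    ∀ j, j < p → v j ≠ 0 := by
  intro j
  induction j with
  | zero => exact fun _ => h0
  | succ j ih =>
    intro hj h
    have h1 := hv.lie 0 (j + 1)
    rw [h, lie_zero, Nat.cast_zero, mul_zero, add_zero, add_zero, Nat.add_sub_cancel] at h1
    exact (smul_ne_zero (natCast_ne_zero_of_lt (Nat.succ_pos j) hj) (ih (by omega))) h1.symm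

variable [Fact p.Prime]

/-- A weight functional killing the images of all `x^k d/dx` with `2 ≤ k` is supported on one member
of a density family, which can be other than the first only for the exponents `0` and `1`. -/
theorem IsDensityFamily.exists_support {b : F} {v : ℕ → V} (hp : p ≠ 2)
    (hv : IsDensityFamily p b v) {θ : Module.Dual F V} (hθ : θ ≠ 0) {a : F}
    (h2 : ∀ k, 2 ≤ k → ∀ u, θ ⁅E F p k, u⁆ = 0) (h1 : ∀ u, θ ⁅E F p 1, u⁆ = a * θ u) :
    ∃ j, θ (v j) ≠ 0 ∧ a = j + b ∧ (j = 0 ∨ (j = 1 ∧ b = 0) ∨ b = 1) := by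
  obtain ⟨j, hj⟩ : ∃ j, θ (v j) ≠ 0 := by
    by_contra! hc
    refine hθ (LinearMap.ext_on_range (v := v) hv.span fun j => ?_)
    rw [hc, LinearMap.zero_apply]
  have hE : ∀ i k, 2 ≤ k → i + k = j + 1 → (i : F) + b * k = 0 := by
    intro i k hk hik
    have h := h2 k hk (v i)
    rw [hv.lie, map_smul, show i + k - 1 = j by omega, smul_eq_mul] at h
    exact (mul_eq_zero.1 h).resolve_right hj
  refine ⟨j, hj, ?_, ?_⟩
  · have h := h1 (v j)
    rw [hv.lie, map_smul, Nat.add_sub_cancel, smul_eq_mul, Nat.cast_one, mul_one] at h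
    exact (mul_right_cancel₀ hj h).symm
  · rcases Nat.lt_trichotomy j 1 with h | rfl | h
    · left; omega
    · right; left
      have h := hE 0 2 le_rfl rfl
      have h2 : ((2 : ℕ) : F) ≠ 0 := natCast_ne_zero_of_lt (by omega)
        (lt_of_le_of_ne (Fact.out : p.Prime).two_le hp.symm)
      rw [Nat.cast_zero, zero_add] at h
      exact ⟨rfl, (mul_eq_zero.1 h).resolve_right h2⟩
    · right; right
      obtain ⟨i, rfl⟩ := Nat.exists_eq_add_of_le' h
      have e1 := hE (i + 1) 2 le_rfl rfl
      have e2 := hE i 3 (by omega) rfl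
      push_cast at e1 e2
      linear_combination e2 - e1

variable [LieModule F (WittAlgebra F p) V]

omit [Fact p.Prime] in
/-- The members of the family are eigenvectors of `x d/dx` for distinct eigenvalues. -/
theorem IsDensityFamily.linearIndependent {b : F} {v : ℕ → V} (hv : IsDensityFamily p b v)
    (h0 : v 0 ≠ 0) : LinearIndependent F fun j : Fin p => v j := by
  refine Module.End.eigenvectors_linearIndependent'
    (LieModule.toEnd F (WittAlgebra F p) V (E F p 1)) (fun j : Fin p => ((j : ℕ) : F) + b) ?_ _ ?_
  · intro i j hij
    exact Fin.ext (CharP.natCast_injOn_Iio F p i.2 j.2 (add_right_cancel hij))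
  · intro j
    refine ⟨Module.End.mem_eigenspace_iff.2 ?_, hv.ne_zero h0 j j.2⟩
    rw [LieModule.toEnd_apply_apply, hv.lie, Nat.cast_one, mul_one, Nat.add_sub_cancel]

/-- A density family starting with a nonzero vector restricts to a basis. -/
noncomputable def IsDensityFamily.basis {b : F} {v : ℕ → V} (hv : IsDensityFamily p b v)
    (h0 : v 0 ≠ 0) : Module.Basis (Fin p) F V :=
  .mk (hv.linearIndependent h0) (by
    rw [← hv.span, Submodule.span_le]
    rintro _ ⟨j, rfl⟩
    by_cases hj : j < p
    · exact Submodule.subset_span ⟨⟨j, hj⟩, rfl⟩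
    · rw [hv.eq_zero j (by omega)]
      exact Submodule.zero_mem _)

omit [Fact p.Prime] in
theorem IsDensityFamily.basis_apply {b : F} {v : ℕ → V} (hv : IsDensityFamily p b v)
    (h0 : v 0 ≠ 0) (j : Fin p) : hv.basis h0 j = v j := by
  rw [basis, Module.Basis.mk_apply]

omit [Fact p.Prime] in
theorem IsDensityFamily.nonempty_equiv {V' : Type*} [AddCommGroup V'] [Module F V']
    [LieRingModule (WittAlgebra F p) V'] [LieModule F (WittAlgebra F p) V'] {b : F} {v : ℕ → V}
    {v' : ℕ → V'} (hv : IsDensityFamily p b v) (h0 : v 0 ≠ 0) (hv' : IsDensityFamily p b v')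
    (h0' : v' 0 ≠ 0) : Nonempty (V ≃ₗ⁅F, WittAlgebra F p⁆ V') := by
  let f : V ≃ₗ[F] V' := (hv.basis h0).equiv (hv'.basis h0') (Equiv.refl _)
  have hf : ∀ j, f (v j) = v' j := by
    intro j
    by_cases hj : j < p
    · have h := (hv.basis h0).equiv_apply ⟨j, hj⟩ (hv'.basis h0') (Equiv.refl _)
      rwa [hv.basis_apply, Equiv.refl_apply, hv'.basis_apply] at h
    · rw [hv.eq_zero j (by omega), hv'.eq_zero j (by omega), map_zero]
  have hlie : ∀ (u : V) (D : WittAlgebra F p), f ⁅D, u⁆ = ⁅D, f u⁆ := by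
    intro u D
    have hD : D ∈ Submodule.span F (Set.range (E F p)) := by
      rw [span_E]; exact Submodule.mem_top
    have hu : u ∈ Submodule.span F (Set.range v) := by
      rw [hv.span]; exact Submodule.mem_top
    induction hu using Submodule.span_induction with
    | zero => rw [lie_zero, map_zero, lie_zero]
    | add x y _ _ hx hy => rw [lie_add, map_add, map_add, lie_add, hx, hy]
    | smul a x _ hx => rw [lie_smul, map_smul, map_smul, lie_smul, hx]
    | mem x hx =>
      obtain ⟨j, rfl⟩ := hx
      induction hD using Submodule.span_induction with
      | zero => rw [zero_lie, map_zero, zero_lie]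
      | add x y _ _ hx hy => rw [add_lie, map_add, add_lie, hx, hy]
      | smul a x _ hx => rw [smul_lie, map_smul, smul_lie, hx]
      | mem x hx =>
        obtain ⟨k, rfl⟩ := hx
        rw [hv.lie, map_smul, hf, hf, hv'.lie]
  exact ⟨{ f with map_lie' := fun {D u} => hlie u D }⟩

/-- An irreducible restricted module is generated by the family of the multiples
`j! (d/dx)^(p-1-j) w` of the descendants of a highest weight vector `w`. -/
theorem IsRestricted.exists_isDensityFamily [IsAlgClosed F]
    [LieModule.IsIrreducible F (WittAlgebra F p) V] (h : IsRestricted F p V) :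
    ∃ (b : F) (v : ℕ → V), IsDensityFamily p b v := by
  have hp : p.Prime := Fact.out
  have : Nontrivial V := LieModule.nontrivial_of_isIrreducible F (WittAlgebra F p) V
  obtain ⟨w, a, hw0, hw, haw⟩ := h.exists_highestWeightVector
  set T := LieModule.toEnd F (WittAlgebra F p) V (E F p 0) with hT
  have hTp : T ^ p = 0 := h.E_pow (by omega)
  let v : ℕ → V := fun j => if j < p then (j.factorial : F) • (T ^ (p - 1 - j)) w else 0
  have hvp : ∀ j, p ≤ j → v j = 0 := fun j hj => if_neg (by omega)
  have h0 : ∀ j, ⁅E F p 0, v j⁆ = (j : F) • v (j - 1) := by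
    intro j
    rcases Nat.lt_or_ge j p with hj | hj
    · simp only [v, if_pos hj, if_pos (show j - 1 < p by omega), lie_smul]
      rw [← LieModule.toEnd_apply_apply F (WittAlgebra F p) V, ← hT, ← Module.End.mul_apply,
        ← pow_succ']
      rcases Nat.eq_zero_or_pos j with rfl | hj0
      · rw [show p - 1 - 0 + 1 = p by omega, hTp]
        simp
      · rw [show p - 1 - j + 1 = p - 1 - (j - 1) by omega, smul_smul, ← Nat.cast_mul,
          Nat.mul_factorial_pred hj0.ne']
    · rw [hvp j hj, lie_zero]
      rcases hj.eq_or_lt with rfl | hj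
      · rw [CharP.cast_eq_zero, zero_smul]
      · rw [hvp (j - 1) (by omega), smul_zero]
  -- Downward induction on `j`, starting from the highest weight vector: the action on `v j` follows
  -- from that on `v (j + 1)`, since `d/dx` maps `v (j + 1)` to `(j + 1) • v j`.
  have hlie : ∀ j, j < p → ∀ k, 1 ≤ k →
      ⁅E F p k, v j⁆ = ((j : F) + (a + 1) * k) • v (j + k - 1) := by
    intro j hj
    refine Nat.decreasingInduction' (P := fun j => ∀ k, 1 ≤ k →
      ⁅E F p k, v j⁆ = ((j : F) + (a + 1) * k) • v (j + k - 1)) (m := j) (n := p - 1)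
      ?_ (by omega) ?_
    · intro j hj _ ih k hk
      have hj1 : ((j + 1 : ℕ) : F) ≠ 0 := natCast_ne_zero_of_lt (Nat.succ_pos j) (by omega)
      have e0 : ((j + 1 : ℕ) : F) • v j = ⁅E F p 0, v (j + 1)⁆ := (h0 (j + 1)).symm
      have e1 : ⁅E F p (k - 1), v (j + 1)⁆ =
          (((j + 1 : ℕ) : F) + (a + 1) * ((k : F) - 1)) • v (j + k - 1) := by
        rcases hk.eq_or_lt with rfl | hk1
        · rw [show 1 - 1 = 0 from rfl, h0]
          simp
        · rw [ih (k - 1) (by omega), Nat.cast_sub hk, Nat.cast_one,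
            show j + 1 + (k - 1) - 1 = j + k - 1 by omega]
      refine smul_right_injective V hj1 ?_
      change ((j + 1 : ℕ) : F) • ⁅E F p k, v j⁆ = ((j + 1 : ℕ) : F) • _
      rw [← lie_smul, e0, leibniz_lie, ih k hk, E_lie, lie_smul, h0, smul_lie, add_zero, e1,
        show j + 1 + k - 1 - 1 = j + k - 1 by omega, show j + 1 + k - 1 = j + k by omega,
        smul_smul, smul_smul, smul_smul, ← add_smul]
      congr 1
      push_cast
      ring
    · intro k hk
      have hvw : v (p - 1) = ((p - 1).factorial : F) • w := by
        simp only [v, if_pos (show p - 1 < p by have := hp.pos; omega), Nat.sub_self, pow_zero,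
          Module.End.one_apply]
      have hp1 : ((p - 1 : ℕ) : F) = -1 := by
        rw [Nat.cast_sub hp.one_le, CharP.cast_eq_zero, Nat.cast_one, zero_sub]
      rcases hk.eq_or_lt with rfl | hk
      · rw [Nat.add_sub_cancel, hvw, lie_smul, haw, hp1, smul_comm]
        congr 1
        push_cast
        ring
      · rw [hvp (p - 1 + k - 1) (by omega), hvw, lie_smul, hw k hk, smul_zero, smul_zero]
  have hfam : ∀ k j, ⁅E F p k, v j⁆ = ((j : F) + (a + 1) * k) • v (j + k - 1) := by
    intro k j
    rcases Nat.eq_zero_or_pos k with rfl | hk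
    · rw [h0, Nat.cast_zero, mul_zero, add_zero, add_zero]
    · rcases Nat.lt_or_ge j p with hj | hj
      · exact hlie j hj k hk
      · rw [hvp j hj, hvp _ (by omega), lie_zero, smul_zero]
  refine ⟨a + 1, v, hfam, hvp, span_eq_top_of_E (F := F) (p := p) _ ?_
    (Set.mem_range_self (p - 1)) ?_⟩
  · rintro _ ⟨j, rfl⟩ k
    rw [hfam]
    exact Submodule.smul_mem _ _ (Submodule.subset_span ⟨_, rfl⟩)
  · simp only [v, if_pos (show p - 1 < p by have := hp.pos; omega), Nat.sub_self, pow_zero,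
      Module.End.one_apply]
    refine smul_ne_zero ?_ hw0
    rw [Ne, CharP.cast_eq_zero_iff F p, hp.dvd_factorial]
    have := hp.pos
    omega

/-- For exponent `1`, the densities `x^j dx` with `j < p - 1` span a submodule, the exact forms, on
which `d/dx` acts surjectively; as `d/dx` is nilpotent, the submodule is zero. -/
theorem IsDensityFamily.isTrivial_of_eq_one [LieModule.IsIrreducible F (WittAlgebra F p) V]
    (h : IsRestricted F p V) {v : ℕ → V} (hv : IsDensityFamily p (1 : F) v) :
    LieModule.IsTrivial (WittAlgebra F p) V := by
  have hp : p.Prime := Fact.out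
  have hV : Nontrivial V := LieModule.nontrivial_of_isIrreducible F (WittAlgebra F p) V
  by_cases hz : ∀ j, j + 1 < p → v j = 0
  · refine isTrivial_of_E (F := F) (p := p) (w := v (p - 1)) ?_ ?_
    · intro hp0
      have hall : ∀ j, v j = 0 := by
        intro j
        by_cases hj : j + 1 < p
        · exact hz j hj
        by_cases hj' : p ≤ j
        · exact hv.eq_zero j hj'
        · rwa [show j = p - 1 by omega]
      have hs := hv.span
      rw [Submodule.span_eq_bot.2 (by rintro _ ⟨j, rfl⟩; exact hall j)] at hs
      exact bot_ne_top hs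
    · intro k
      rw [hv.lie, Nat.cast_sub hp.one_le, CharP.cast_eq_zero, Nat.cast_one]
      rcases Nat.lt_trichotomy k 1 with hk | rfl | hk
      · rw [hz _ (by have := hp.two_le; omega), smul_zero]
      · simp
      · rw [hv.eq_zero _ (by omega), smul_zero]
  · push Not at hz
    obtain ⟨j, hj, hj0⟩ := hz
    exfalso
    have hs := span_eq_top_of_E (F := F) (p := p) (v '' {j | j + 1 < p}) (by
      rintro _ ⟨j, hj, rfl⟩ k
      change j + 1 < p at hj
      rw [hv.lie]
      by_cases h1 : j + k = p
      · rw [one_mul, ← Nat.cast_add, h1, CharP.cast_eq_zero, zero_smul]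
        exact Submodule.zero_mem _
      by_cases h2 : j + k < p
      · exact Submodule.smul_mem _ _ (Submodule.subset_span ⟨_, by
          change j + k - 1 + 1 < p; omega, rfl⟩)
      · rw [hv.eq_zero _ (by omega), smul_zero]
        exact Submodule.zero_mem _) (Set.mem_image_of_mem v hj) hj0
    set T := LieModule.toEnd F (WittAlgebra F p) V (E F p 0) with hT
    have hsurj : Function.Surjective T := by
      rw [← LinearMap.range_eq_top, eq_top_iff, ← hs, Submodule.span_le]
      rintro _ ⟨i, hi, rfl⟩
      have hi1 : ((i + 1 : ℕ) : F) ≠ 0 := natCast_ne_zero_of_lt (Nat.succ_pos i) hi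
      refine ⟨((i + 1 : ℕ) : F)⁻¹ • v (i + 1), ?_⟩
      rw [map_smul, hT, LieModule.toEnd_apply_apply, hv.lie, Nat.cast_zero, mul_zero, add_zero,
        inv_smul_smul₀ hi1, add_zero, Nat.add_sub_cancel]
    have hTp : Function.Surjective (T ^ p) := by
      rw [Module.End.coe_pow]
      exact hsurj.iterate p
    rw [h.E_pow (by omega)] at hTp
    obtain ⟨u, hu⟩ := exists_ne (0 : V)
    obtain ⟨w, hw⟩ := hTp u
    exact hu hw.symm

omit [Fact p.Prime] in
theorem IsDensityFamily.apply_lie_of_apply_eq_zero {b : F} {v : ℕ → V}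
    (hv : IsDensityFamily p b v) {θ : Module.Dual F V} (hθ : ∀ j, j ≠ 0 → θ (v j) = 0) :
    (∀ k, 2 ≤ k → ∀ u, θ ⁅E F p k, u⁆ = 0) ∧ ∀ u, θ ⁅E F p 1, u⁆ = b * θ u := by
  constructor
  · intro k hk
    refine LinearMap.congr_fun (f := θ ∘ₗ LieModule.toEnd F (WittAlgebra F p) V (E F p k)) (g := 0)
      (LinearMap.ext_on_range hv.span fun j => ?_)
    rw [LinearMap.comp_apply, LieModule.toEnd_apply_apply, hv.lie, map_smul, hθ _ (by omega),
      smul_zero, LinearMap.zero_apply]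
  · refine LinearMap.congr_fun (f := θ ∘ₗ LieModule.toEnd F (WittAlgebra F p) V (E F p 1))
      (g := b • θ) (LinearMap.ext_on_range hv.span fun j => ?_)
    rw [LinearMap.comp_apply, LieModule.toEnd_apply_apply, hv.lie, map_smul, Nat.cast_one, mul_one,
      Nat.add_sub_cancel, LinearMap.smul_apply]
    by_cases hj : j = 0
    · rw [hj, Nat.cast_zero, zero_add]
    · rw [hθ j hj, smul_zero, smul_zero]

/-- A nonzero submodule of a module of densities contains a nonzero vector killed by `d/dx`, which
is a multiple of the first basis vector; and that vector generates the module unless the exponent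
is `0` or `1`. -/
theorem IsDensityFamily.isIrreducible [IsAlgClosed F] (hp : p ≠ 2) (h : IsRestricted F p V) {b : F}
    {v : ℕ → V} (hv : IsDensityFamily p b v) (hv0 : v 0 ≠ 0) (hb0 : b ≠ 0) (hb1 : b ≠ 1) :
    LieModule.IsIrreducible F (WittAlgebra F p) V := by
  have hpp : p.Prime := Fact.out
  have hp2 := hpp.two_le
  have : Nontrivial V := ⟨v 0, 0, hv0⟩
  refine LieModule.IsIrreducible.mk fun N hN => ?_
  obtain ⟨u, hu, hu0, hTu⟩ := exists_ker_mem
    (LieModule.toEnd F (WittAlgebra F p) V (E F p 0)) N.toSubmodule (fun u hu => N.lie_mem hu)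
    (fun hb => hN ((LieSubmodule.toSubmodule_eq_bot N).1 hb)) (h.E_pow (by omega))
  set β := hv.basis hv0 with hβ
  -- `d/dx` lowers the index, so it moves the coordinate `i + 1` to the coordinate `i`.
  have hcoord : ∀ i (hi : i + 1 < p), β.coord ⟨i, by omega⟩ ∘ₗ
      LieModule.toEnd F (WittAlgebra F p) V (E F p 0) =
        ((i + 1 : ℕ) : F) • β.coord ⟨i + 1, hi⟩ := by
    intro i hi
    refine β.ext fun j => ?_
    rw [LinearMap.comp_apply, LinearMap.smul_apply, β.coord_apply ⟨i + 1, hi⟩,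
      Module.Basis.repr_self, hβ, hv.basis_apply, LieModule.toEnd_apply_apply, hv.lie,
      Nat.cast_zero, mul_zero, add_zero, add_zero, map_smul]
    obtain ⟨j, hj⟩ := j
    change (j : F) • (hv.basis hv0).coord _ (v (j - 1)) = _
    have hj1 := hv.basis_apply hv0 ⟨j - 1, by omega⟩
    change _ = v (j - 1) at hj1
    rw [← hj1, Module.Basis.coord_apply, Module.Basis.repr_self, Finsupp.single_apply,
      Finsupp.single_apply]
    rcases Nat.eq_zero_or_pos j with rfl | hj0
    · simp
    · by_cases hij : j = i + 1
      · subst hij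
        simp
      · rw [if_neg (by rw [Fin.mk.injEq]; omega), if_neg (by rw [Fin.mk.injEq]; omega), smul_zero,
          smul_zero]
  have huv : u = β.repr u ⟨0, by omega⟩ • v 0 := by
    conv_lhs => rw [← β.sum_repr u]
    rw [Finset.sum_eq_single ⟨0, by omega⟩, hβ, hv.basis_apply]
    · rintro ⟨j, hj⟩ _ hj0
      obtain ⟨i, rfl⟩ : ∃ i, j = i + 1 :=
        Nat.exists_eq_succ_of_ne_zero fun h0 => hj0 (Fin.ext h0)
      have hc := LinearMap.congr_fun (hcoord i hj) u
      rw [LinearMap.comp_apply, hTu, map_zero, LinearMap.smul_apply, Module.Basis.coord_apply] at hc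
      rw [(smul_eq_zero.1 hc.symm).resolve_left (natCast_ne_zero_of_lt (Nat.succ_pos i) hj),
        zero_smul]
    · exact fun hc => absurd (Finset.mem_univ _) hc
  have hc0 : β.repr u ⟨0, by omega⟩ ≠ 0 := by
    intro hc
    rw [hc, zero_smul] at huv
    exact hu0 huv
  have h0N : v 0 ∈ N := by
    have hm : β.repr u ⟨0, by omega⟩ • v 0 ∈ N.toSubmodule := huv ▸ hu
    exact (N.toSubmodule.smul_mem_iff hc0).1 hm
  have hlow : ∀ j, j + 1 < p → v j ∈ N := by
    intro j hj
    have hm := N.lie_mem (x := E F p (j + 1)) h0N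
    rw [hv.lie, Nat.cast_zero, zero_add, zero_add, Nat.add_sub_cancel] at hm
    exact (N.toSubmodule.smul_mem_iff
      (mul_ne_zero hb0 (natCast_ne_zero_of_lt (Nat.succ_pos j) hj))).1 hm
  have hall : ∀ j, v j ∈ N := by
    intro j
    by_cases hj : j + 1 < p
    · exact hlow j hj
    by_cases hj' : p ≤ j
    · rw [hv.eq_zero j hj']
      exact N.zero_mem
    obtain rfl : j = p - 1 := by omega
    have hm := N.lie_mem (x := E F p 2) (hlow (p - 2) (by omega))
    have h2 : ((2 : ℕ) : F) ≠ 0 := natCast_ne_zero_of_lt (p := p) (by omega) (by omega)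
    rw [hv.lie, show p - 2 + 2 - 1 = p - 1 by omega, Nat.cast_sub hp2, CharP.cast_eq_zero,
      show (0 : F) - (2 : ℕ) + b * (2 : ℕ) = (2 : ℕ) * (b - 1) by ring] at hm
    exact (N.toSubmodule.smul_mem_iff (mul_ne_zero h2 (sub_ne_zero.2 hb1))).1 hm
  rw [← LieSubmodule.toSubmodule_eq_top, eq_top_iff, ← hv.span, Submodule.span_le]
  rintro _ ⟨j, rfl⟩
  exact hall j

end Density

/-! ### Semi-invariant bilinear forms -/

/-- The values `ψ i j = θ (v i · v j)` of an invariant product on a density family of exponent `b`,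
composed with a functional `θ` of weight `a` that kills the images of all `x^k d/dx`, `2 ≤ k`. -/
structure IsSemiInvariantForm {F : Type*} [Field F] (p : ℕ) (b a : F) (ψ : ℕ → ℕ → F) : Prop where
  rel : ∀ k i j : ℕ, 2 ≤ k →
    ((i : F) + b * k) * ψ (i + k - 1) j + ((j : F) + b * k) * ψ i (j + k - 1) = 0
  weight : ∀ i j : ℕ, ψ i j ≠ 0 → (i : F) + j + 2 * b = a
  left : ∀ i j, p ≤ i → ψ i j = 0
  right : ∀ i j, p ≤ j → ψ i j = 0

section Form

variable {F : Type*} [Field F] {p : ℕ} [CharP F p] {ψ : ℕ → ℕ → F}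

omit [CharP F p] in
/-- The relation of a form of exponent `-n`, for `x^(k+1) d/dx` and indices of sum `n - k`. -/
theorem IsSemiInvariantForm.rel_neg {n k i j : ℕ} {a : F}
    (h : IsSemiInvariantForm p (-(n : F)) a ψ) (hk : 1 ≤ k) :
    ((i : F) - n * (k + 1)) * ψ (i + k) j + ((j : F) - n * (k + 1)) * ψ i (j + k) = 0 := by
  have := h.rel (k + 1) i j (by omega)
  push_cast at this
  rw [show i + (k + 1) - 1 = i + k by omega, show j + (k + 1) - 1 = j + k by omega] at this
  linear_combination this

/-- A form of exponent `-n` is determined by its value at `(0, n)`: the values with `i + j = n` are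
multiples of it, and those with `i + j = n + p` vanish. -/
theorem IsSemiInvariantForm.eq_zero {n : ℕ} (hn : 1 ≤ n) (hnp : n + 1 < p)
    (h : IsSemiInvariantForm p (-(n : F)) (-(n : F)) ψ) (h0 : ψ 0 n = 0) (i j : ℕ) :
    ψ i j = 0 := by
  by_contra hij
  have hi : i < p := by
    by_contra hc
    exact hij (h.left i j (by omega))
  have hj : j < p := by
    by_contra hc
    exact hij (h.right i j (by omega))
  have hn0 : (n : F) ≠ 0 := natCast_ne_zero_of_lt (p := p) (by omega) (by omega)
  have hmod : ((i + j : ℕ) : F) = (n : ℕ) := by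
    push_cast
    linear_combination h.weight i j hij
  rw [CharP.natCast_eq_natCast F p] at hmod
  have hcase : i + j = n ∨ i + j = n + p := by
    rw [Nat.ModEq, Nat.mod_eq_of_lt (show n < p by omega)] at hmod
    have h1 := Nat.mod_add_div (i + j) p
    rw [hmod] at h1
    have h2 : (i + j) / p < 2 := Nat.div_lt_of_lt_mul (by omega)
    interval_cases (i + j) / p <;> omega
  rcases hcase with hs | hs
  · rcases Nat.eq_zero_or_pos i with rfl | hi0
    · rw [zero_add] at hs
      exact hij (hs ▸ h0)
    · have hr := h.rel_neg (i := 0) (j := j) hi0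
      rw [show j + i = n by omega, h0, zero_add, mul_zero, add_zero] at hr
      have hi1 : ((i + 1 : ℕ) : F) ≠ 0 := natCast_ne_zero_of_lt (p := p) (by omega) (by omega)
      push_cast at hr hi1
      rw [zero_sub, neg_mul, neg_eq_zero] at hr
      exact (mul_ne_zero (mul_ne_zero hn0 hi1) hij) hr
  · -- the step `k = i - n` moves the second index to `j + k = p`, where the form vanishes
    obtain ⟨k, rfl⟩ := Nat.exists_eq_add_of_le (show n ≤ i by omega)
    have hk : 1 ≤ k := by omega
    have hk0 : (k : F) ≠ 0 := natCast_ne_zero_of_lt (p := p) (by omega) (by omega)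
    have hr := h.rel_neg (i := n) (j := j) hk
    rw [h.right n (j + k) (by omega), mul_zero, add_zero] at hr
    have : (n : F) * k * ψ (n + k) j = 0 := by linear_combination -hr
    exact (mul_ne_zero (mul_ne_zero hn0 hk0) hij) this

/-- The values at `(0, n)` and `(n, 0)` are opposite, and each determines the values at
`(1, n - 1)`, `(2, n - 2)` and their transposes. The two answers agree only if `3 n = 2` and
`5 n = 8`, so that `14 = 0`. -/
theorem IsSemiInvariantForm.eq_seven {n : ℕ} (hp : p.Prime) (hp5 : 5 ≤ p) (hn : 2 ≤ n)
    (hnp : n + 1 < p) {a : F} (h : IsSemiInvariantForm p (-(n : F)) a ψ) (h0 : ψ 0 n ≠ 0) :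
    p = 7 ∧ n = 3 := by
  have hn0 : (n : F) ≠ 0 := natCast_ne_zero_of_lt (p := p) (by omega) (by omega)
  have hn1 : (n : F) + 1 ≠ 0 := by
    have := natCast_ne_zero_of_lt (F := F) (p := p) (Nat.succ_pos n) (by omega)
    exact_mod_cast this
  have hL : ∀ k j, 1 ≤ k → j + k = n →
      (n : F) * (k + 1) * ψ k j + (k : F) * (n + 1) * ψ 0 n = 0 := by
    intro k j hk hjk
    have hr := h.rel_neg (i := 0) (j := j) hk
    rw [hjk, zero_add] at hr
    have hj : (j : F) = n - k := by rw [← hjk]; push_cast; ring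
    rw [hj] at hr
    push_cast at hr
    linear_combination -hr
  have hR : ∀ k i, 1 ≤ k → i + k = n →
      (n : F) * (k + 1) * ψ i k + (k : F) * (n + 1) * ψ n 0 = 0 := by
    intro k i hk hik
    have hr := h.rel_neg (i := i) (j := 0) hk
    rw [hik, zero_add] at hr
    have hi : (i : F) = n - k := by rw [← hik]; push_cast; ring
    rw [hi] at hr
    push_cast at hr
    linear_combination -hr
  have hopp : ψ n 0 = -ψ 0 n := by
    have h1 := hL n 0 (by omega) (by omega)
    refine mul_left_cancel₀ (mul_ne_zero hn0 hn1) ?_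
    linear_combination h1
  rw [hopp] at hR
  have h3 : (3 : F) * n = 2 := by
    obtain ⟨i, hi⟩ := Nat.exists_eq_add_of_le' (show 1 ≤ n by omega)
    have h1 := hL i 1 (by omega) (by omega)
    have h2 := hR 1 i le_rfl (by omega)
    have hi' : (i : F) = n - 1 := by rw [hi]; push_cast; ring
    rw [hi'] at h1
    push_cast at h2
    refine mul_left_cancel₀ (mul_ne_zero hn1 h0) ?_
    linear_combination 2 * h1 - n * h2
  have h5 : 3 ≤ n → (5 : F) * n = 8 := by
    intro hn3
    obtain ⟨i, hi⟩ := Nat.exists_eq_add_of_le' (show 2 ≤ n by omega)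
    have h1 := hL i 2 (by omega) (by omega)
    have h2 := hR 2 i (by omega) (by omega)
    have hi' : (i : F) = n - 2 := by rw [hi]; push_cast; ring
    rw [hi'] at h1
    push_cast at h2
    refine mul_left_cancel₀ (mul_ne_zero hn1 h0) ?_
    linear_combination 3 * h1 - (n - 1) * h2
  have h4 : n ≠ 2 := by
    rintro rfl
    have h4 := natCast_ne_zero_of_lt (F := F) (p := p) (n := 4) (by omega) (by omega)
    push_cast at h4 h3
    exact h4 (by linear_combination h3)
  have h14 : ((14 : ℕ) : F) = 0 := by
    push_cast
    linear_combination 5 * h3 - 3 * h5 (by omega)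
  rw [CharP.cast_eq_zero_iff F p, show 14 = 2 * 7 from rfl, hp.dvd_mul,
    Nat.prime_dvd_prime_iff_eq hp Nat.prime_two,
    Nat.prime_dvd_prime_iff_eq hp (by norm_num)] at h14
  obtain rfl : p = 7 := by omega
  refine ⟨rfl, ?_⟩
  have h3' : ((3 * n : ℕ) : F) = (2 : ℕ) := by exact_mod_cast h3
  rw [CharP.natCast_eq_natCast F 7, Nat.ModEq] at h3'
  omega

/-- For the functions modulo constants there is no nonzero form at all. -/
theorem IsSemiInvariantForm.eq_zero_of_exponent_zero (h : IsSemiInvariantForm p (0 : F) 1 ψ)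
    (h0 : ∀ j, ψ 0 j = 0) (h0' : ∀ i, ψ i 0 = 0) (i j : ℕ) : ψ i j = 0 := by
  have h1 : ∀ j, ψ 1 j = 0 := by
    intro j
    by_contra hc
    have hw := h.weight 1 j hc
    have hj : (j : F) = 0 := by
      push_cast at hw
      linear_combination hw
    rw [CharP.cast_eq_zero_iff F p] at hj
    rcases Nat.eq_zero_or_pos j with rfl | hj0
    · exact hc (h0' 1)
    · exact hc (h.right 1 j (Nat.le_of_dvd hj0 hj))
  rcases Nat.lt_trichotomy i 1 with hi | rfl | hi
  · obtain rfl : i = 0 := by omega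
    exact h0 j
  · exact h1 j
  · have hr := h.rel i 1 j hi
    rw [h1, show 1 + i - 1 = i by omega] at hr
    simpa using hr

end Form

/-! ### Invariant products on irreducible modules -/

section Product

variable {F : Type*} [Field F] {p : ℕ} [CharP F p] [Fact p.Prime]
  {V : Type*} [AddCommGroup V] [Module F V] [LieRingModule (WittAlgebra F p) V]
  [LieModule F (WittAlgebra F p) V]

omit [Fact p.Prime] in
theorem IsDensityFamily.isSemiInvariantForm {b a : F} {v : ℕ → V} (hv : IsDensityFamily p b v)
    {B : V →ₗ[F] V →ₗ[F] V} (hB : IsInvariantProduct F (WittAlgebra F p) B) {θ : Module.Dual F V}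
    (h2 : ∀ k, 2 ≤ k → ∀ u, θ ⁅E F p k, u⁆ = 0) (h1 : ∀ u, θ ⁅E F p 1, u⁆ = a * θ u) :
    IsSemiInvariantForm p b a fun i j => θ (B (v i) (v j)) where
  rel k i j hk := by
    have h := h2 k hk (B (v i) (v j))
    simpa only [hB (E F p k), hv.lie, map_add, map_smul, LinearMap.smul_apply, smul_eq_mul] using h
  weight i j hij := by
    have h := h1 (B (v i) (v j))
    simp only [hB (E F p 1), hv.lie, map_add, map_smul, LinearMap.smul_apply, smul_eq_mul,
      Nat.add_sub_cancel] at h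
    refine mul_right_cancel₀ hij ?_
    push_cast at h
    linear_combination h
  left i j hi := by simp only [hv.eq_zero i hi, map_zero, LinearMap.zero_apply]
  right i j hj := by simp only [hv.eq_zero j hj, map_zero]

omit [Fact p.Prime] in
/-- The image of an invariant product spans a submodule, which is zero if a nonzero functional
vanishes on it. -/
theorem IsDensityFamily.product_eq_zero [LieModule.IsIrreducible F (WittAlgebra F p) V] {b : F}
    {v : ℕ → V} (hv : IsDensityFamily p b v) {B : V →ₗ[F] V →ₗ[F] V}
    (hB : IsInvariantProduct F (WittAlgebra F p) B) {θ : Module.Dual F V} (hθ : θ ≠ 0)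
    (h : ∀ i j, θ (B (v i) (v j)) = 0) : B = 0 := by
  let S : Set V := Set.range fun ij : ℕ × ℕ => B (v ij.1) (v ij.2)
  have hS : ∀ i j, B (v i) (v j) ∈ Submodule.span F S := fun i j =>
    Submodule.subset_span ⟨(i, j), rfl⟩
  refine LinearMap.ext_on_range hv.span fun i => LinearMap.ext_on_range hv.span fun j => ?_
  rw [LinearMap.zero_apply, LinearMap.zero_apply]
  by_contra hij
  have htop := span_eq_top_of_E (F := F) (p := p) S (by
    rintro _ ⟨ij, rfl⟩ k
    simp only [hB (E F p k), hv.lie, map_smul, LinearMap.smul_apply]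
    exact Submodule.add_mem _ (Submodule.smul_mem _ _ (hS _ _))
      (Submodule.smul_mem _ _ (hS _ _))) ⟨(i, j), rfl⟩ hij
  refine hθ (LinearMap.ext_on htop ?_)
  rintro _ ⟨ij, rfl⟩
  exact h _ _

omit [CharP F p] [Fact p.Prime] in
theorem IsInvariantProduct.smul {B : V →ₗ[F] V →ₗ[F] V}
    (hB : IsInvariantProduct F (WittAlgebra F p) B) (a : F) :
    IsInvariantProduct F (WittAlgebra F p) (a • B) := by
  intro D u w
  simp only [LinearMap.smul_apply, lie_smul, hB D, smul_add]

omit [Fact p.Prime] in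
/-- On a module of densities of exponent `-n`, an invariant product is determined by the leading
coefficient of the product of the members `0` and `n` of the family. -/
theorem IsDensityFamily.product_ext [LieModule.IsIrreducible F (WittAlgebra F p) V] {n : ℕ}
    {v : ℕ → V} (hv : IsDensityFamily p (-(n : F)) v) {θ : Module.Dual F V} (hθ : θ ≠ 0)
    (h2 : ∀ k, 2 ≤ k → ∀ u, θ ⁅E F p k, u⁆ = 0) (h1 : ∀ u, θ ⁅E F p 1, u⁆ = -(n : F) * θ u)
    (hn : 1 ≤ n) (hnp : n + 1 < p) {B B' : V →ₗ[F] V →ₗ[F] V}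
    (hB : IsInvariantProduct F (WittAlgebra F p) B)
    (hB' : IsInvariantProduct F (WittAlgebra F p) B')
    (h : θ (B (v 0) (v n)) = θ (B' (v 0) (v n))) : B = B' := by
  have hinv : IsInvariantProduct F (WittAlgebra F p) (B - B') := by
    intro D u w
    simp only [LinearMap.sub_apply, lie_sub, hB D, hB' D]
    abel
  refine sub_eq_zero.1 (hv.product_eq_zero hinv hθ
    ((hv.isSemiInvariantForm hinv h2 h1).eq_zero hn hnp ?_))
  rw [LinearMap.sub_apply, LinearMap.sub_apply, map_sub, h, sub_self]

/-- An admissible module either has a density family of exponent other than `0`, `1` and `-1` that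
starts with a nonzero vector, or is the space of functions modulo constants, of exponent `0`. The
exponent `1` would give the trivial module and `-1` the adjoint module. The functional comes from a
highest weight vector of the dual module. -/
theorem IsAdmissible.exists_isDensityFamily [IsAlgClosed F] (hp : p ≠ 2)
    (h : IsAdmissible F p V) :
    ∃ (b : F) (v : ℕ → V) (θ : Module.Dual F V), IsDensityFamily p b v ∧ θ ≠ 0 ∧
      (∀ k, 2 ≤ k → ∀ u, θ ⁅E F p k, u⁆ = 0) ∧
      ((b ≠ 0 ∧ b ≠ 1 ∧ b ≠ -1 ∧ v 0 ≠ 0 ∧ ∀ u, θ ⁅E F p 1, u⁆ = b * θ u) ∨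
        (b = 0 ∧ v 0 = 0 ∧ ∀ u, θ ⁅E F p 1, u⁆ = 1 * θ u)) := by
  have := h.irreducible
  have : Nontrivial V := LieModule.nontrivial_of_isIrreducible F (WittAlgebra F p) V
  obtain ⟨b, v, hv⟩ := h.restricted.exists_isDensityFamily
  obtain ⟨θ, a, hθ, hθ2, hθ1⟩ := (h.restricted.dual hp).exists_highestWeightVector
  have h2 : ∀ k, 2 ≤ k → ∀ u, θ ⁅E F p k, u⁆ = 0 := by
    intro k hk u
    have := LinearMap.congr_fun (hθ2 k hk) u
    rwa [Module.Dual.lie_apply, LinearMap.zero_apply, neg_eq_zero] at this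
  have h1 : ∀ u, θ ⁅E F p 1, u⁆ = -a * θ u := by
    intro u
    have := LinearMap.congr_fun hθ1 u
    rw [Module.Dual.lie_apply, LinearMap.smul_apply, smul_eq_mul] at this
    linear_combination -this
  have hb1 : b ≠ 1 := by
    rintro rfl
    exact h.non_trivial (hv.isTrivial_of_eq_one h.restricted)
  have hb0 : b = 0 → v 0 = 0 := by
    rintro rfl
    by_contra hv0
    refine h.non_trivial (isTrivial_of_E hv0 fun k => ?_)
    rw [hv.lie, Nat.cast_zero, zero_mul, add_zero, zero_smul]
  obtain ⟨j, hj, ha, rfl | ⟨rfl, hb⟩ | hb⟩ := hv.exists_support hp hθ h2 h1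
  · have hv0 : v 0 ≠ 0 := by
      intro h0
      rw [h0, map_zero] at hj
      exact hj rfl
    rw [Nat.cast_zero, zero_add] at ha
    rw [ha] at h1
    refine ⟨b, v, θ, hv, hθ, h2, Or.inl ⟨fun hb => hv0 (hb0 hb), hb1, ?_, hv0, h1⟩⟩
    rintro rfl
    have hE0 : E F p 0 ≠ 0 := by
      intro h0
      have h3 := E_root (F := F) (p := p) 0
      have : Nontrivial (TruncPoly F p) := AdjoinRoot.nontrivial _ (by
        rw [Polynomial.degree_X_pow]
        exact_mod_cast (Fact.out : p.Prime).ne_zero)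
      rw [h0, Derivation.zero_apply, pow_zero] at h3
      exact zero_ne_one h3
    exact (hv.nonempty_equiv hv0 isDensityFamily_E hE0).elim h.non_adjoint.elim
  · rw [hb, Nat.cast_one, add_zero] at ha
    rw [ha] at h1
    exact ⟨b, v, θ, hv, hθ, h2, Or.inr ⟨hb, hb0 hb, h1⟩⟩
  · exact absurd hb hb1

/-- A nonzero invariant product exists only for `p = 7`, on the module of densities of exponent
`-3 = 4`. -/
theorem IsAdmissible.exists_isDensityFamily_four [IsAlgClosed F] (hp : 5 ≤ p)
    (h : IsAdmissible F p V) {B : V →ₗ[F] V →ₗ[F] V}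
    (hB : IsInvariantProduct F (WittAlgebra F p) B) (hB0 : B ≠ 0) :
    p = 7 ∧ ∃ v : ℕ → V, IsDensityFamily p (4 : F) v ∧ v 0 ≠ 0 := by
  have hirr := h.irreducible
  have hpp : p.Prime := Fact.out
  obtain ⟨b, v, θ, hv, hθ, h2, ⟨hb0, hb1, hb2, hv0, h1⟩ | ⟨rfl, hv0, h1⟩⟩ :=
    h.exists_isDensityFamily (by omega)
  · have hψ := hv.isSemiInvariantForm hB h2 h1
    obtain ⟨i, j, hij⟩ : ∃ i j, θ (B (v i) (v j)) ≠ 0 := by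
      by_contra! hc
      exact hB0 (hv.product_eq_zero hB hθ hc)
    -- a nonzero value forces the exponent into the prime field
    obtain ⟨n, hnp, rfl⟩ : ∃ n : ℕ, n < p ∧ b = -(n : F) := by
      refine ⟨(i + j) % p, Nat.mod_lt _ hpp.pos, ?_⟩
      rw [← CharP.cast_eq_mod F p]
      push_cast
      linear_combination hψ.weight i j hij
    have hn0 : n ≠ 0 := by
      rintro rfl
      simp at hb0
    have hn1 : n ≠ 1 := by
      rintro rfl
      simp at hb2
    have hn2 : n + 1 ≠ p := by
      rintro rfl
      have := CharP.cast_eq_zero F (n + 1)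
      push_cast at this
      exact hb1 (by linear_combination -this)
    have hne : θ (B (v 0) (v n)) ≠ 0 := fun h0 =>
      hij (hψ.eq_zero (by omega) (by omega) h0 i j)
    obtain ⟨rfl, rfl⟩ := hψ.eq_seven hpp hp (by omega) (by omega) hne
    refine ⟨rfl, v, ?_, hv0⟩
    have h7 := CharP.cast_eq_zero F 7
    push_cast at h7
    rwa [show -((3 : ℕ) : F) = 4 by push_cast; linear_combination -h7] at hv
  · refine absurd (hv.product_eq_zero hB hθ fun i j => ?_) hB0
    refine (hv.isSemiInvariantForm hB h2 h1).eq_zero_of_exponent_zero ?_ ?_ i j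
    · intro j
      simp only [hv0, map_zero, LinearMap.zero_apply]
    · intro i
      simp only [hv0, map_zero]

end Product

/-! ### The module `V₆` is restricted -/

section Twist

variable {F : Type*} [Field F]

/-- If `T` satisfies a Leibniz rule with respect to `R` and `S`, then in characteristic `p` so do
the `p`-th powers: on `A ⊗ A` the operators `R ⊗ 1` and `1 ⊗ S` commute. -/
theorem leibniz_pow_char {A : Type*} [CommRing A] [Nontrivial A] [Algebra F A] (p : ℕ)
    [Fact p.Prime] [CharP F p] {R S T : Module.End F A}
    (h : ∀ f g, T (f * g) = R f * g + f * S g) (f g : A) :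
    (T ^ p) (f * g) = (R ^ p) f * g + f * (S ^ p) g := by
  have : CharP (Module.End F (TensorProduct F A A)) p :=
    charP_of_injective_algebraMap (algebraMap F (Module.End F (TensorProduct F A A))).injective p
  have hc : Commute (LinearMap.rTensor A R) (LinearMap.lTensor A S) := by
    refine TensorProduct.ext' fun a b => ?_
    simp [Module.End.mul_apply]
  have hμ : T ∘ₗ LinearMap.mul' F A =
      LinearMap.mul' F A ∘ₗ (LinearMap.rTensor A R + LinearMap.lTensor A S) := by
    refine TensorProduct.ext' fun a b => ?_
    simp [h]
  have hp : ∀ n : ℕ, (T ^ n) ∘ₗ LinearMap.mul' F A =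
      LinearMap.mul' F A ∘ₗ ((LinearMap.rTensor A R + LinearMap.lTensor A S) ^ n) :=
    fun n => Module.End.commute_pow_left_of_commute hμ n
  have := LinearMap.congr_fun (hp p) (TensorProduct.tmul F f g)
  rw [add_pow_char_of_commute p hc, LinearMap.rTensor_pow, LinearMap.lTensor_pow] at this
  simpa using this

variable (F) [CharP F 7]

/-- The action of `D` on the densities of exponent `n`, that is, on `F[X]/(X^7)` with `D` twisted by
`n` times its divergence. -/
noncomputable def twEnd (n : ℕ) (D : WittAlgebra F 7) : Module.End F (TruncPoly F 7) :=
  (D : TruncPoly F 7 →ₗ[F] TruncPoly F 7) + n • LinearMap.mulLeft F (ddx F (D (AdjoinRoot.root _)))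

theorem twEnd_apply (n : ℕ) (D : WittAlgebra F 7) (a : TruncPoly F 7) :
    twEnd F n D a = D a + n * (ddx F (D (AdjoinRoot.root _)) * a) := by
  simp [twEnd]

/-- For exponent `1` the action on `h' dx` is that of `D` on `h`, differentiated. -/
theorem twEnd_one_pow_one (D : WittAlgebra F 7) (n : ℕ) :
    (twEnd F 1 D ^ n) 1 = ddx F (D^[n] (AdjoinRoot.root _)) := by
  have h1 : ∀ a, twEnd F 1 D (ddx F a) = ddx F (D a) := by
    intro a
    rw [twEnd_apply, eq_mul_ddx F D a, eq_mul_ddx F D (ddx F a), Derivation.leibniz, smul_eq_mul,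
      smul_eq_mul, Nat.cast_one]
    ring
  rw [← ddx_root F, Module.End.pow_apply]
  exact ((Function.Semiconj.iterate_right (f := ddx F) (ga := D) (gb := twEnd F 1 D)
    (fun a => (h1 a).symm) n) _).symm

theorem twEnd_pow_seven (n : ℕ) (D : WittAlgebra F 7) : twEnd F n D ^ 7 = twEnd F n (pMap 7 D) := by
  have : Nontrivial (TruncPoly F 7) := AdjoinRoot.nontrivial _ (by
    rw [Polynomial.degree_X_pow]
    norm_num)
  induction n with
  | zero =>
    ext a
    rw [twEnd_apply, pMap_apply, Module.End.pow_apply]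
    simp [twEnd]
  | succ n ih =>
    ext a
    have h := leibniz_pow_char (F := F) 7 (T := twEnd F (n + 1) D) (R := twEnd F n D)
      (S := twEnd F 1 D) (fun f g => by
        simp only [twEnd_apply, Derivation.leibniz, smul_eq_mul]
        push_cast
        ring) a 1
    rw [mul_one, mul_one] at h
    rw [h, ih, twEnd_one_pow_one, twEnd_apply, twEnd_apply, pMap_apply, pMap_apply]
    push_cast
    ring

theorem isRestricted_V6 : IsRestricted F 7 (V6 F) := by
  intro D
  have htw : ∀ (D : WittAlgebra F 7) (v : V6 F), toTrunc F ⁅D, v⁆ = twEnd F 4 D (toTrunc F v) := by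
    intro D v
    rw [V6_lie_def, toTrunc_V6act, tw, twEnd_apply]
    rfl
  refine LinearMap.ext fun v => toTrunc_injective F ?_
  have hpow := Function.Semiconj.iterate_right (f := toTrunc F)
    (ga := LieModule.toEnd F (WittAlgebra F 7) (V6 F) D) (gb := twEnd F 4 D) (htw D) 7 v
  rw [Module.End.pow_apply, hpow, LieModule.toEnd_apply_apply, htw, ← twEnd_pow_seven,
    Module.End.pow_apply]

/-! ### `V₆` as a module of densities -/

/-- The basis `m` of `V₆`, extended by zero. -/
noncomputable def mSeq (j : ℕ) : V6 F := if h : j < 7 then m F ⟨j, h⟩ else 0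

omit [CharP F 7] in
theorem mSeq_fin (i : Fin 7) : mSeq F i = m F i := dif_pos i.2

omit [CharP F 7] in
theorem m_ne_zero (i : Fin 7) : m F i ≠ 0 := by
  rw [← mBasis_apply]
  exact (mBasis F).ne_zero i

omit [CharP F 7] in
theorem eEnd_m (k i : Fin 7) :
    eEnd F k (m F i) = ((i : ℕ) + 4 * (k : ℕ) : F) • mSeq F ((i : ℕ) + (k : ℕ) - 1) := by
  rw [eEnd, ← mBasis_apply, Module.Basis.constr_basis]
  split_ifs with h
  · rw [mSeq, dif_pos]
  · by_cases h1 : 1 ≤ (i : ℕ) + (k : ℕ)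
    · rw [mSeq, dif_neg (by omega), smul_zero]
    · have hi : (i : ℕ) = 0 := by omega
      have hk : (k : ℕ) = 0 := by omega
      simp [hi, hk]

theorem isDensityFamily_mSeq : IsDensityFamily 7 (4 : F) (mSeq F) where
  lie k j := by
    by_cases hj : j < 7
    · by_cases hk : k < 7
      · have h := V6_lie_e F ⟨k, hk⟩ (E F 7 k) (E_root k) (mSeq F j)
        rw [h, mSeq_fin F ⟨j, hj⟩, eEnd_m]
      · rw [E_eq_zero (by omega), zero_lie]
        by_cases h7 : j + k = 7
        · obtain rfl : j = 0 := by omega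
          obtain rfl : k = 7 := by omega
          rw [CharP.cast_eq_zero F 7, Nat.cast_zero, mul_zero, add_zero, zero_smul]
        · rw [mSeq, dif_neg (by omega), smul_zero]
    · rw [mSeq, dif_neg hj, lie_zero]
      rcases (show 7 ≤ j by omega).eq_or_lt with rfl | hj'
      · rcases Nat.eq_zero_or_pos k with rfl | hk
        · rw [CharP.cast_eq_zero, Nat.cast_zero, mul_zero, add_zero, zero_smul]
        · rw [mSeq, dif_neg (by omega), smul_zero]
      · rw [mSeq, dif_neg (by omega), smul_zero]
  eq_zero j hj := dif_neg (by omega)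
  span := by
    rw [eq_top_iff, ← (mBasis F).span_eq, Submodule.span_le]
    rintro _ ⟨i, rfl⟩
    rw [mBasis_apply, ← mSeq_fin]
    exact Submodule.subset_span ⟨_, rfl⟩

theorem isAdmissible_V6 [IsAlgClosed F] : IsAdmissible F 7 (V6 F) := by
  have h0 : mSeq F 0 ≠ 0 := m_ne_zero F 0
  have h4 : (4 : F) ≠ 0 := by
    have := natCast_ne_zero_of_lt (F := F) (p := 7) (n := 4) (by omega) (by omega)
    exact_mod_cast this
  have h3 : (4 : F) ≠ 1 := by
    have := natCast_ne_zero_of_lt (F := F) (p := 7) (n := 3) (by omega) (by omega)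
    push_cast at this
    exact fun h => this (by linear_combination h)
  have hE1 : ⁅E F 7 1, mSeq F 0⁆ = (4 : F) • mSeq F 0 := by
    rw [(isDensityFamily_mSeq F).lie]
    norm_num
  refine ⟨(isDensityFamily_mSeq F).isIrreducible (by norm_num) (isRestricted_V6 F) h0 h4 h3,
    isRestricted_V6 F, fun ht => ?_, ⟨fun φ => ?_⟩⟩
  · rw [ht.trivial] at hE1
    exact smul_ne_zero h4 h0 hE1.symm
  · -- a vector field killed by `d/dx` is an eigenvector of `x d/dx` for `-1`, not for `4`
    have hφ : ∀ D u, φ ⁅D, u⁆ = ⁅D, φ u⁆ := fun D u => φ.toLieModuleHom.map_lie D u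
    have hw0 : ⁅E F 7 0, φ (mSeq F 0)⁆ = 0 := by
      rw [← hφ, (isDensityFamily_mSeq F).lie]
      simp
    have hw1 : ⁅E F 7 1, φ (mSeq F 0)⁆ = (4 : F) • φ (mSeq F 0) := by
      rw [← hφ, hE1, map_smul]
    generalize hw : φ (mSeq F 0) = w at hw0 hw1
    have e0 := congrArg (fun D : WittAlgebra F 7 => D (AdjoinRoot.root _)) hw0
    have e1 := congrArg (fun D : WittAlgebra F 7 => D (AdjoinRoot.root _)) hw1
    simp only [Derivation.commutator_apply, E_root, pow_zero, pow_one, Derivation.map_one_eq_zero,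
      Derivation.zero_apply, Derivation.smul_apply, sub_zero] at e0 e1
    have hE : ∀ a, E F 7 1 a = AdjoinRoot.root _ * E F 7 0 a := by
      intro a
      rw [E, E, Derivation.smul_apply, Derivation.smul_apply, pow_one, pow_zero, one_smul,
        smul_eq_mul]
    have h5 : (5 : F) ≠ 0 := by
      have := natCast_ne_zero_of_lt (F := F) (p := 7) (n := 5) (by omega) (by omega)
      exact_mod_cast this
    rw [hE, e0, mul_zero, zero_sub] at e1
    have hw2 : (5 : F) • w (AdjoinRoot.root _) = 0 := by
      rw [show (5 : F) = 4 + 1 by norm_num, add_smul, one_smul, ← e1, neg_add_cancel]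
    have hw3 : w = 0 := witt_ext ((smul_eq_zero.1 hw2).resolve_left h5)
    rw [hw3] at hw
    exact h0 (φ.injective (hw.trans (map_zero φ.toLieModuleHom).symm))

end Twist

/-! ### The product of `V₆` -/

section SevenProduct

/-- The structure constants of the product of `V₆`, as elements of the prime field. -/
def primeC (i j : Fin 7) : ZMod 7 :=
  2 * ((j : ℕ) - (i : ℕ) : ZMod 7) * (4 * (i : ℕ) + (j : ℕ) - 1) * (4 * (j : ℕ) + (i : ℕ) - 1)

/-- The coefficient of the action of `x^k d/dx` on `m i`, as an element of the prime field. It is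
zero when the index `i + k - 1` leaves the range `0, …, 6`, so that the index can be read
modulo `7`. -/
def primeE (k i : Fin 7) : ZMod 7 :=
  if 1 ≤ (i : ℕ) + (k : ℕ) ∧ (i : ℕ) + (k : ℕ) ≤ 7 then (i : ℕ) + 4 * (k : ℕ) else 0

theorem primeC_invariant : ∀ k i j : Fin 7, primeC i j * primeE k (i + j - 3) =
    primeE k i * primeC (i + k - 1) j + primeE k j * primeC i (j + k - 1) := by
  decide

/-- The coefficient of the monomial in the `r`-th summand of the transvectant of `m i` and `m j`,
up to the binomial coefficient and the sign. -/
def transCoeff (i j r : ℕ) : ℕ :=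
  i.descFactorial r * (6 - i).descFactorial (3 - r) *
    (j.descFactorial (3 - r) * (6 - j).descFactorial r)

theorem primeC_eq_transCoeff : ∀ i j : Fin 7, primeC i j =
    transCoeff i j 0 - 3 * transCoeff i j 1 + 3 * transCoeff i j 2 - transCoeff i j 3 := by
  decide

/-- The index of the product is only reduced modulo `7` where the structure constant is zero. -/
theorem primeC_eq_zero_or : ∀ i j : Fin 7, primeC i j = 0 ∨
    (3 ≤ (i : ℕ) + j ∧ (i : ℕ) + j ≤ 9 ∧ ((i + j - 3 : Fin 7) : ℕ) = (i : ℕ) + j - 3) := by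
  decide

variable (F : Type*) [Field F]

theorem iterate_pderiv_monomial (i : Fin 2) (n : ℕ) (s : Fin 2 →₀ ℕ) (a : F) :
    (MvPolynomial.pderiv i)^[n] (MvPolynomial.monomial s a) =
      MvPolynomial.monomial (s - Finsupp.single i n) (a * (s i).descFactorial n) := by
  induction n with
  | zero => simp
  | succ n ih =>
    rw [Function.iterate_succ_apply', ih, MvPolynomial.pderiv_monomial, tsub_tsub,
      ← Finsupp.single_add, Finsupp.tsub_apply, Finsupp.single_eq_same, Nat.descFactorial_succ,
      mul_assoc, ← Nat.cast_mul, mul_comm (s i - n)]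

theorem iterate_pderiv_smul (i : Fin 2) (n : ℕ) (a : F) (f : MvPolynomial (Fin 2) F) :
    (MvPolynomial.pderiv i)^[n] (a • f) = a • (MvPolynomial.pderiv i)^[n] f :=
  Function.Commute.iterate_left (f := MvPolynomial.pderiv i) (g := (a • ·))
    (fun f => (MvPolynomial.pderiv i).map_smul a f) n f

/-- The transvectant `(f, g)_3` of forms of degree `6`, as a bilinear map. -/
noncomputable def transvectantLin :
    V6 F →ₗ[F] V6 F →ₗ[F] MvPolynomial (Fin 2) F :=
  LinearMap.mk₂ F (fun f g => transvectant 6 6 3 f g)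
    (fun f f' g => by
      simp only [transvectant, Submodule.coe_add, iterate_map_add, add_mul, smul_add,
        Finset.sum_add_distrib])
    (fun a f g => by
      simp only [transvectant, Submodule.coe_smul, iterate_pderiv_smul, smul_mul_assoc]
      rw [smul_comm a, Finset.smul_sum (r := a)]
      exact congrArg _ (Finset.sum_congr rfl fun r _ => smul_comm _ _ _))
    (fun f g g' => by
      simp only [transvectant, Submodule.coe_add, iterate_map_add, mul_add, smul_add,
        Finset.sum_add_distrib])
    (fun a f g => by
      simp only [transvectant, Submodule.coe_smul, iterate_pderiv_smul, mul_smul_comm]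
      rw [smul_comm a, Finset.smul_sum (r := a)]
      exact congrArg _ (Finset.sum_congr rfl fun r _ => smul_comm _ _ _))

/-- Each summand of the transvectant of `m i` and `m j` is a multiple of one and the same
monomial. -/
theorem transvectant_summand (i j : Fin 7) {r : ℕ} (hr : r ≤ 3) :
    ((MvPolynomial.pderiv 0)^[3 - r]
        ((MvPolynomial.pderiv 1)^[r] (m F i : MvPolynomial (Fin 2) F))) *
      ((MvPolynomial.pderiv 0)^[r]
        ((MvPolynomial.pderiv 1)^[3 - r] (m F j : MvPolynomial (Fin 2) F))) =
    MvPolynomial.monomial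
      (Finsupp.single 0 (9 - ((i : ℕ) + j)) + Finsupp.single 1 ((i : ℕ) + j - 3))
      (transCoeff i j r : F) := by
  have h0 : ∀ (i : Fin 7) (n : ℕ), (expo i - Finsupp.single 1 n : Fin 2 →₀ ℕ) 0 = 6 - (i : ℕ) := by
    intro i n
    simp [expo_zero]
  rw [coe_m, coe_m, iterate_pderiv_monomial, iterate_pderiv_monomial, iterate_pderiv_monomial,
    iterate_pderiv_monomial, MvPolynomial.monomial_mul, h0, h0, expo_one, expo_one, one_mul,
    one_mul, ← Nat.cast_mul, ← Nat.cast_mul, ← Nat.cast_mul]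
  change MvPolynomial.monomial _ (transCoeff i j r : F) = _
  by_cases hc : transCoeff i j r = 0
  · rw [hc, Nat.cast_zero, map_zero, map_zero]
  · simp only [transCoeff, mul_eq_zero, Nat.descFactorial_eq_zero_iff_lt, not_or, not_lt] at hc
    refine congrArg (fun s => MvPolynomial.monomial s (transCoeff i j r : F))
      (Finsupp.ext fun a => ?_)
    fin_cases a
    · simp [expo_zero]
      omega
    · simp [expo_one]
      omega

variable [CharP F 7]

theorem c_eq_primeC (i j : Fin 7) : c F i j = ZMod.castHom (dvd_refl 7) F (primeC i j) := by
  simp only [c, primeC, map_mul, map_sub, map_add, map_natCast, map_ofNat, map_one]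

theorem eEnd_m_mod (k i : Fin 7) :
    eEnd F k (m F i) = ZMod.castHom (dvd_refl 7) F (primeE k i) • m F (i + k - 1) := by
  rw [eEnd_m, primeE]
  split_ifs with h
  · have hv : ((i + k - 1 : Fin 7) : ℕ) = (i : ℕ) + k - 1 := by
      revert i k; decide
    rw [← hv, mSeq_fin]
    simp only [map_mul, map_add, map_natCast, map_ofNat]
  · rw [map_zero, zero_smul]
    by_cases h1 : 1 ≤ (i : ℕ) + (k : ℕ)
    · rw [mSeq, dif_neg (by omega), smul_zero]
    · rw [show (i : ℕ) = 0 by omega, show (k : ℕ) = 0 by omega]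
      simp

theorem isInvariantProduct_V6prod : IsInvariantProduct F (WittAlgebra F 7) (V6prod F) := by
  intro D u v
  have hD : D ∈ Submodule.span F (Set.range (E F 7)) := by
    rw [span_E]; exact Submodule.mem_top
  induction hD using Submodule.span_induction with
  | zero => simp
  | add x y _ _ hx hy =>
    simp only [add_lie, map_add, LinearMap.add_apply, hx, hy]
    abel
  | smul a x _ hx => simp only [smul_lie, map_smul, LinearMap.smul_apply, hx, smul_add]
  | mem x hx =>
    obtain ⟨k, rfl⟩ := hx
    by_cases hk : k < 7
    · have he := V6_lie_e F ⟨k, hk⟩ (E F 7 k) (E_root k)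
      rw [he, he, he]
      have key : (V6prod F).compr₂ (eEnd F ⟨k, hk⟩) =
          (V6prod F) ∘ₗ eEnd F ⟨k, hk⟩ + (V6prod F).compl₂ (eEnd F ⟨k, hk⟩) := by
        refine (mBasis F).ext fun i => (mBasis F).ext fun j => ?_
        generalize (⟨k, hk⟩ : Fin 7) = k
        simp only [mBasis_apply, LinearMap.compr₂_apply, LinearMap.add_apply, LinearMap.comp_apply,
          LinearMap.compl₂_apply, V6prod_m, map_smul, eEnd_m_mod, LinearMap.smul_apply, c_eq_primeC,
          smul_smul]
        rw [show i + k - 1 + j - 3 = i + j - 3 + k - 1 by abel,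
          show i + (j + k - 1) - 3 = i + j - 3 + k - 1 by abel, ← add_smul, ← map_mul, ← map_mul,
          ← map_mul, ← map_add, primeC_invariant]
      exact LinearMap.congr_fun₂ key u v
    · rw [E_eq_zero (by omega)]
      simp

theorem c_zero_three_ne_zero : c F 0 3 ≠ 0 := by
  rw [c_eq_primeC, map_ne_zero]
  decide

theorem V6prod_eq_transvectant (f g : V6 F) :
    (V6prod F f g : MvPolynomial (Fin 2) F) =
      transvectant 6 6 3 (f : MvPolynomial (Fin 2) F) g := by
  have key : (V6prod F).compr₂ (Submodule.subtype _) = transvectantLin F := by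
    refine (mBasis F).ext fun i => (mBasis F).ext fun j => ?_
    rw [mBasis_apply, mBasis_apply, LinearMap.compr₂_apply, V6prod_m, Submodule.subtype_apply,
      Submodule.coe_smul, coe_m]
    change _ = transvectant 6 6 3 (m F i : MvPolynomial (Fin 2) F) (m F j : MvPolynomial (Fin 2) F)
    have h7 : (7 : F) = 0 := by exact_mod_cast CharP.cast_eq_zero F 7
    have h6 : (6 : F) ≠ 0 := by
      have := natCast_ne_zero_of_lt (F := F) (p := 7) (n := 6) (by omega) (by omega)
      exact_mod_cast this
    have hfac : ((Nat.factorial (6 - 3) : ℕ) : F) / ((Nat.factorial 6 : ℕ) : F) = 1 := by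
      have h : ((Nat.factorial 6 : ℕ) : F) = 6 := by
        norm_num [Nat.factorial]
        linear_combination 102 * h7
      rw [h, div_eq_one_iff_eq h6]
      norm_num [Nat.factorial]
    -- `3! = 6` and `6! = 720` are equal modulo `7`
    rw [transvectant, hfac, one_mul, one_smul]
    rw [Finset.sum_congr rfl fun r hr => by
      rw [transvectant_summand F i j (Nat.lt_succ_iff.1 (Finset.mem_range.1 hr))]]
    simp only [MvPolynomial.smul_monomial, ← map_sum]
    have hsum : ∑ r ∈ Finset.range (3 + 1), ((-1 : F) ^ r * (Nat.choose 3 r : F)) •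
        (transCoeff i j r : F) = c F i j := by
      rw [c_eq_primeC, primeC_eq_transCoeff]
      simp only [map_mul, map_sub, map_add, map_natCast, map_ofNat]
      simp [Finset.sum_range_succ, Nat.choose]
      ring
    rw [hsum]
    rcases primeC_eq_zero_or i j with h0 | ⟨h3, h9, hv⟩
    · rw [c_eq_primeC, h0]
      simp
    · rw [smul_eq_mul, mul_one, expo, hv]
      rw [show 9 - ((i : ℕ) + j) = 6 - ((i : ℕ) + j - 3) by omega]
  exact LinearMap.congr_fun₂ key f g

/-- The scalar is found by comparing the coefficients of `m 0` in the products of `m 0` and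
`m 3`. -/
theorem exists_eq_smul_V6prod [IsAlgClosed F] {B : V6 F →ₗ[F] V6 F →ₗ[F] V6 F}
    (hB : IsInvariantProduct F (WittAlgebra F 7) B) : ∃ a : F, B = a • V6prod F := by
  have hirr := (isAdmissible_V6 F).irreducible
  have hv := isDensityFamily_mSeq F
  set θ := (mBasis F).coord 0 with hθ
  have hθm : ∀ i, θ (m F i) = if i = 0 then 1 else 0 := by
    intro i
    rw [← mBasis_apply, hθ, Module.Basis.coord_apply, Module.Basis.repr_self,
      Finsupp.single_apply]
  have hθ0 : θ ≠ 0 := by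
    intro h
    have h1 := hθm 0
    rw [h, if_pos rfl] at h1
    exact zero_ne_one h1
  obtain ⟨h2, h1⟩ := hv.apply_lie_of_apply_eq_zero (θ := θ) fun j hj => by
    by_cases hj7 : j < 7
    · have := hθm ⟨j, hj7⟩
      rw [← mSeq_fin, if_neg (fun h => hj (congrArg Fin.val h))] at this
      exact this
    · rw [hv.eq_zero j (by omega), map_zero]
  have h4 : (4 : F) = -((3 : ℕ) : F) := by
    have h7 : ((7 : ℕ) : F) = 0 := CharP.cast_eq_zero F 7
    push_cast at h7 ⊢
    linear_combination h7
  refine ⟨θ (B (m F 0) (m F 3)) / c F 0 3, ?_⟩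
  rw [h4] at h1 hv
  refine hv.product_ext hθ0 h2 h1 (by omega) (by omega) hB
    ((isInvariantProduct_V6prod F).smul _) ?_
  change θ (B (m F 0) (m F 3)) = θ ((_ • V6prod F) (m F 0) (m F 3))
  rw [LinearMap.smul_apply, LinearMap.smul_apply, V6prod_m, map_smul, map_smul, hθm,
    if_pos (by decide), smul_eq_mul, smul_eq_mul, mul_one,
    div_mul_cancel₀ _ (c_zero_three_ne_zero F)]

theorem V6prod_ne_zero : V6prod F ≠ 0 := by
  intro h
  have h1 := V6prod_m F 0 3
  rw [h] at h1
  exact smul_ne_zero (c_zero_three_ne_zero F) (m_ne_zero F _) h1.symm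

end SevenProduct

/-! ### Uniqueness of the product in characteristic seven -/

/-- An admissible module with a nonzero invariant product in characteristic `7` is isomorphic to
`V₆` by comparison of density families; the transported product is a multiple of that of `V₆`. -/
theorem IsAdmissible.exists_equiv_V6 {F : Type*} [Field F] [IsAlgClosed F] [CharP F 7] {V : Type*}
    [AddCommGroup V] [Module F V] [LieRingModule (WittAlgebra F 7) V]
    [LieModule F (WittAlgebra F 7) V] (h : IsAdmissible F 7 V) {B : V →ₗ[F] V →ₗ[F] V}
    (hB : IsInvariantProduct F (WittAlgebra F 7) B) (hB0 : B ≠ 0) :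
    ∃ (φ : V ≃ₗ⁅F, WittAlgebra F 7⁆ V6 F) (a : F), a ≠ 0 ∧
      ∀ u w : V, φ (B u w) = a • V6prod F (φ u) (φ w) := by
  obtain ⟨_, v, hv, hv0⟩ := h.exists_isDensityFamily_four (by norm_num) hB hB0
  obtain ⟨φ⟩ := hv.nonempty_equiv hv0 (isDensityFamily_mSeq F) (m_ne_zero F 0)
  let e : V ≃ₗ[F] V6 F := φ.toLinearEquiv
  have he : ∀ (D : WittAlgebra F 7) u, e ⁅D, u⁆ = ⁅D, e u⁆ := φ.toLieModuleHom.map_lie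
  have he' : ∀ (D : WittAlgebra F 7) u, e.symm ⁅D, u⁆ = ⁅D, e.symm u⁆ := fun D u => by
    rw [LinearEquiv.symm_apply_eq, he, LinearEquiv.apply_symm_apply]
  let B' : V6 F →ₗ[F] V6 F →ₗ[F] V6 F :=
    (B.compl₁₂ (e.symm : V6 F →ₗ[F] V) (e.symm : V6 F →ₗ[F] V)).compr₂ (e : V →ₗ[F] V6 F)
  have hB'_apply : ∀ u w, B' u w = e (B (e.symm u) (e.symm w)) := fun _ _ => rfl
  obtain ⟨a, ha⟩ := exists_eq_smul_V6prod F (B := B') fun D u w => by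
    rw [hB'_apply, hB'_apply, hB'_apply, ← he, hB D, he', he', map_add]
  have hφ : ∀ u w, e (B u w) = a • V6prod F (e u) (e w) := by
    intro u w
    have := hB'_apply (e u) (e w)
    rw [e.symm_apply_apply, e.symm_apply_apply, ha] at this
    exact this.symm
  refine ⟨φ, a, ?_, hφ⟩
  rintro rfl
  refine hB0 (LinearMap.ext₂ fun u w => e.injective ?_)
  rw [hφ, zero_smul, LinearMap.zero_apply, LinearMap.zero_apply, map_zero]

end WittAlg

theorem mainTheorem3 {F : Type u} [Field F] [IsAlgClosed F] :
    -- characteristic `p ≥ 5`, `p ≠ 7`: there is no nonzero invariant product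
    (∀ (p : ℕ) [Fact p.Prime] [CharP F p], 5 ≤ p → p ≠ 7 →
      ∀ (V : Type v) [AddCommGroup V] [Module F V] [LieRingModule (WittAlg.WittAlgebra F p) V]
        [LieModule F (WittAlg.WittAlgebra F p) V],
        WittAlg.IsAdmissible F p V →
        ∀ B : V →ₗ[F] V →ₗ[F] V,
          WittAlg.IsInvariantProduct F (WittAlg.WittAlgebra F p) B → B = 0) ∧
    -- characteristic `7`
    (∀ [CharP F 7],
      -- `V₆` is such a module, and its product is a nonzero invariant product, namely the
      -- `3`-transvectant
      WittAlg.IsAdmissible F 7 (WittAlg.V6 F) ∧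
      WittAlg.IsInvariantProduct F (WittAlg.WittAlgebra F 7) (WittAlg.V6prod F) ∧
      WittAlg.V6prod F ≠ 0 ∧
      (∀ f g : WittAlg.V6 F, (WittAlg.V6prod F f g : MvPolynomial (Fin 2) F) =
        WittAlg.transvectant 6 6 3 (f : MvPolynomial (Fin 2) F) (g : MvPolynomial (Fin 2) F)) ∧
      -- it is the only invariant product on `V₆`, up to scaling
      (∀ B : WittAlg.V6 F →ₗ[F] WittAlg.V6 F →ₗ[F] WittAlg.V6 F,
        WittAlg.IsInvariantProduct F (WittAlg.WittAlgebra F 7) B →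
        ∃ a : F, B = a • WittAlg.V6prod F) ∧
      -- every such module with a nonzero invariant product is `V₆` with its product, up to
      -- isomorphism and scaling of the product
      (∀ (V : Type v) [AddCommGroup V] [Module F V] [LieRingModule (WittAlg.WittAlgebra F 7) V]
        [LieModule F (WittAlg.WittAlgebra F 7) V],
        WittAlg.IsAdmissible F 7 V →
        ∀ B : V →ₗ[F] V →ₗ[F] V,
          WittAlg.IsInvariantProduct F (WittAlg.WittAlgebra F 7) B → B ≠ 0 →
          ∃ (φ : V ≃ₗ⁅F, WittAlg.WittAlgebra F 7⁆ WittAlg.V6 F) (a : F), a ≠ 0 ∧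
            ∀ u w : V, φ (B u w) = a • WittAlg.V6prod F (φ u) (φ w))) := by
  refine ⟨?_, ?_⟩
  · intro p _ _ hp hp7 V _ _ _ _ hV B hB
    by_contra hB0
    exact hp7 (hV.exists_isDensityFamily_four hp hB hB0).1
  · intro _
    refine ⟨WittAlg.isAdmissible_V6 F, WittAlg.isInvariantProduct_V6prod F,
      WittAlg.V6prod_ne_zero F, WittAlg.V6prod_eq_transvectant F, ?_, ?_⟩
    · intro B hB
      exact WittAlg.exists_eq_smul_V6prod F hB
    · intro V _ _ _ _ hV B hB hB0
      exact hV.exists_equiv_V6 hB hB0
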